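/- Let $1\le k\le n$ be integers. Let $G_{n,k}$ be the Grassmannian of $k$-dimensional linear subspaces of $\mathbb R^n$ with its rotation-invariant (Haar) probability measure $\mu_{n,k}$, and let $M_{n,k}$ be the Grassmannian of $k$-dimensional affine subspaces of $\mathbb R^n$ with the rigid-motion invariant measure $$\nu_{n,k}(A)=\int_{G_{n,k}}\bigl|\{x\in E^{\perp}: x+E\in A\}\bigr|\,d\mu_{n,k}(E),$$ where $|\cdot|$ is Lebesgue measure on $E^\perp$. For a measurable function $f$ on $\mathbb R^n$, a real number $p\neq 0$ and $F\in M_{n,k}$ put $\|f|_F\|_p=\bigl(\int_F|f|^p\bigr)^{1/p}\in[0,\infty]$, the integral being with respect to $k$-dimensional Lebesgue measure on $F$. **Theorem.** Let $m$ be a positive integer, and let $p_i\ne 0$ and $\alpha_i$, $i=1,\dots,m$, be real numbers with $\sum_{i=1}^m \frac{\alpha_i}{p_i}=n+1$. Let $f_1,\dots,f_m$ be bounded measurable real- or complex-valued functions on $\mathbb R^n$ with $f_i\in L^{p_i}(\mathbb R^n)$, that is, $\int_{\mathbb R^n}|f_i|^{p_i}<\infty$. Define $$\tilde I(f_1,\dots,f_m):=\int_{M_{n,k}}\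 \prod_{i=1}^m \|f_i|_F\|_{p_i}^{\alpha_i}\ d\nu_{n,k}(F)\in[0,\infty],$$ with the conventions $0^{a}=\infty$ and $\infty^{a}=0$ for $a<0$, $0^0=\infty^0=1$, and $0\cdot\infty=0$. If $\tilde I(f_1,\dots,f_m)<\infty$, then for every volume-preserving affine transformation $g$ of $\mathbb R^n$, $$\tilde I(g\cdot f_1,\dots,g\cdot f_m)=\tilde I(f_1,\dots,f_m),\qquad\text{where } (g\cdot f_i)(t)=f_i(g^{-1}t).$$ -/

import Mathlib

open MeasureTheory Set Topology
open scoped ENNReal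

noncomputable section

namespace AffineGrass

/-- Euclidean space `ℝⁿ`. -/
abbrev Space (n : ℕ) : Type := EuclideanSpace ℝ (Fin n)

/-! ### The Grassmannian of `k`-dimensional linear subspaces -/

/-- The Grassmannian `G_{n,k}` of `k`-dimensional linear subspaces of `ℝⁿ`. -/
def Grassmannian (n k : ℕ) : Type :=
  {E : Submodule ℝ (Space n) // Module.finrank ℝ E = k}

namespace Grassmannian

variable {n k : ℕ}

/-- The orthogonal projection of `ℝⁿ` onto `E`. -/
def proj (E : Grassmannian n k) : Space n →L[ℝ] Space n := E.1.starProjection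

/-- The usual topology: subspaces are close when their orthogonal projections are. -/
instance : TopologicalSpace (Grassmannian n k) :=
  TopologicalSpace.induced proj inferInstance

instance : MeasurableSpace (Grassmannian n k) := borel _

instance : BorelSpace (Grassmannian n k) := ⟨rfl⟩

lemma continuous_proj : Continuous (proj : Grassmannian n k → _) := continuous_induced_dom

end Grassmannian

/-- The orthogonal group `O(n)`. -/
abbrev OrthGroup (n : ℕ) : Type := Matrix.orthogonalGroup (Fin n) ℝ

section OrthGroup

variable {n : ℕ}

instance : MeasurableSpace (OrthGroup n) := borel _

instance : BorelSpace (OrthGroup n) := ⟨rfl⟩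

instance : CompactSpace (OrthGroup n) := by
  refine (isCompact_iff_compactSpace (X := Matrix (Fin n) (Fin n) ℝ)
    (s := (Matrix.orthogonalGroup (Fin n) ℝ : Set (Matrix (Fin n) (Fin n) ℝ)))).1 ?_
  have hK : IsCompact (X := Matrix (Fin n) (Fin n) ℝ)
      (Set.univ.pi fun _ => Set.univ.pi fun _ => Set.Icc (-1 : ℝ) 1) :=
    isCompact_univ_pi fun _ => isCompact_univ_pi fun _ => isCompact_Icc
  refine hK.of_isClosed_subset (isClosed_unitary (R := Matrix (Fin n) (Fin n) ℝ)) ?_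
  intro U hU i _ j _
  have := entry_norm_bound_of_unitary hU i j
  rw [Real.norm_eq_abs, abs_le] at this
  exact this

/-- The Haar probability measure of `O(n)`. -/
def orthHaar (n : ℕ) : Measure (OrthGroup n) := Measure.haarMeasure ⊤

instance : IsProbabilityMeasure (orthHaar n) :=
  ⟨Measure.haarMeasure_self (K₀ := (⊤ : TopologicalSpace.PositiveCompacts (OrthGroup n)))⟩

/-- The linear isometry `x ↦ U x` of `ℝⁿ` given by an orthogonal matrix `U`. -/
def orthAct (U : OrthGroup n) : Space n ≃ₗᵢ[ℝ] Space n :=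
  Unitary.linearIsometryEquiv
    ⟨Matrix.toEuclideanCLM (n := Fin n) (𝕜 := ℝ) U.1, by
      rw [Unitary.mem_iff]
      constructor
      · rw [← map_star, ← map_mul, (Unitary.mem_iff.1 U.2).1, map_one]
      · rw [← map_star, ← map_mul, (Unitary.mem_iff.1 U.2).2, map_one]⟩

lemma orthAct_apply (U : OrthGroup n) (x : Space n) :
    orthAct U x = Matrix.toEuclideanCLM (n := Fin n) (𝕜 := ℝ) U.1 x := rfl

end OrthGroup

namespace Grassmannian

variable {n k : ℕ}

/-- The image `U E` of a subspace `E` under an orthogonal matrix `U`. -/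
def rotate (U : OrthGroup n) (E : Grassmannian n k) : Grassmannian n k :=
  ⟨E.1.map (orthAct U).toLinearEquiv.toLinearMap, by
    rw [LinearEquiv.finrank_map_eq]; exact E.2⟩

/-- The coordinate subspace `ℝ e₁ ⊕ ⋯ ⊕ ℝ e_k`. -/
def coord (h : k ≤ n) : Grassmannian n k :=
  ⟨Submodule.span ℝ (Set.range fun i : Fin k =>
      EuclideanSpace.basisFun (Fin n) ℝ (Fin.castLE h i)), by
    have hli : LinearIndependent ℝ fun i : Fin k =>
        EuclideanSpace.basisFun (Fin n) ℝ (Fin.castLE h i) :=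
      (EuclideanSpace.basisFun (Fin n) ℝ).orthonormal.linearIndependent.comp _
        (Fin.castLE_injective h)
    simpa using finrank_span_eq_card hli⟩

/-- The Haar probability measure `μ_{n,k}` on `G_{n,k}`: the law of `U (ℝ e₁ ⊕ ⋯ ⊕ ℝ e_k)` for a
Haar distributed `U ∈ O(n)`. -/
def haar (h : k ≤ n) : Measure (Grassmannian n k) :=
  (orthHaar n).map fun U => rotate U (coord h)

lemma measurable_proj : Measurable (proj : Grassmannian n k → _) :=
  continuous_proj.measurable

lemma measurable_of_proj {X : Type*} [MeasurableSpace X] {φ : X → Grassmannian n k}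
    (hφ : Measurable fun x => proj (φ x)) : Measurable φ := by
  refine measurable_of_isOpen fun s hs => ?_
  obtain ⟨t, ht, rfl⟩ := isOpen_induced_iff.1 hs
  exact hφ ht.measurableSet

lemma proj_rotate (U : OrthGroup n) (E : Grassmannian n k) :
    proj (rotate U E) = (Matrix.toEuclideanCLM (n := Fin n) (𝕜 := ℝ) U.1).comp
      ((proj E).comp (Matrix.toEuclideanCLM (n := Fin n) (𝕜 := ℝ) (star U.1))) := by
  ext1 x
  have hs : Matrix.toEuclideanCLM (n := Fin n) (𝕜 := ℝ) (star U.1) x = (orthAct U).symm x := by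
    rw [map_star]; rfl
  rw [ContinuousLinearMap.comp_apply, ContinuousLinearMap.comp_apply, hs]
  exact Submodule.starProjection_map_apply (orthAct U) E.1 x

lemma continuous_rotate (E : Grassmannian n k) : Continuous fun U => rotate U E := by
  refine continuous_induced_rng.2 ?_
  have hc : Continuous (Matrix.toEuclideanCLM (n := Fin n) (𝕜 := ℝ)) :=
    LinearMap.continuous_of_finiteDimensional
      (Matrix.toEuclideanCLM (n := Fin n) (𝕜 := ℝ)).toAlgEquiv.toLinearMap
  have : (proj ∘ fun U => rotate U E) = fun U : OrthGroup n =>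
      (Matrix.toEuclideanCLM (n := Fin n) (𝕜 := ℝ) U.1).comp
      ((proj E).comp (Matrix.toEuclideanCLM (n := Fin n) (𝕜 := ℝ) (star U.1))) :=
    funext fun U => proj_rotate U E
  rw [this]
  have h1 := hc.comp (continuous_subtype_val (p := (· ∈ Matrix.orthogonalGroup (Fin n) ℝ)))
  have h2 := hc.comp (continuous_star.comp
    (continuous_subtype_val (p := (· ∈ Matrix.orthogonalGroup (Fin n) ℝ))))
  exact h1.clm_comp (continuous_const.clm_comp h2)

lemma rotate_mul (U V : OrthGroup n) (E : Grassmannian n k) :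
    rotate (U * V) E = rotate U (rotate V E) := by
  refine Subtype.ext ?_
  simp only [rotate]
  rw [← Submodule.map_comp]
  congr 1
  ext1 x
  simp [orthAct_apply]

instance (h : k ≤ n) : IsProbabilityMeasure (haar h) :=
  Measure.isProbabilityMeasure_map (continuous_rotate _).measurable.aemeasurable

lemma measurable_rotate (U : OrthGroup n) :
    Measurable (rotate U : Grassmannian n k → Grassmannian n k) := by
  refine measurable_of_proj ?_
  simp only [proj_rotate]
  exact (continuous_const.clm_comp (continuous_proj.clm_comp continuous_const)).measurable

/-- `μ_{n,k}` is invariant under rotations. -/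
lemma map_rotate_haar (h : k ≤ n) (U : OrthGroup n) : (haar h).map (rotate U) = haar h := by
  have h1 := (continuous_rotate (coord h)).measurable
  have hU : (orthHaar n).map (U * ·) = orthHaar n := by
    unfold orthHaar; exact map_mul_left_eq_self _ U
  rw [haar, Measure.map_map (measurable_rotate U) h1]
  conv_rhs => rw [← hU, Measure.map_map h1 (continuous_const_mul U).measurable]
  congr 1
  ext1 V
  exact (rotate_mul U V _).symm

end Grassmannian

/-! ### The affine Grassmannian of `k`-dimensional affine subspaces -/

/-- The affine Grassmannian `M_{n,k}` of `k`-dimensional affine subspaces of `ℝⁿ`. -/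
def AffineGrassmannian (n k : ℕ) : Type :=
  {F : AffineSubspace ℝ (Space n) //
    (F : Set (Space n)).Nonempty ∧ Module.finrank ℝ F.direction = k}

namespace AffineGrassmannian

variable {n k : ℕ}

/-- The linear subspace parallel to `F`. -/
def dir (F : AffineGrassmannian n k) : Grassmannian n k := ⟨F.1.direction, F.2.2⟩

/-- The point of `F` closest to the origin. -/
def foot (F : AffineGrassmannian n k) : Space n :=
  haveI : Nonempty F.1 := F.2.1.to_subtype
  EuclideanGeometry.orthogonalProjection F.1 0

/-- The usual topology: affine subspaces are close when their directions and their points closest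
to the origin are. -/
instance : TopologicalSpace (AffineGrassmannian n k) :=
  TopologicalSpace.induced (fun F => (F.dir, F.foot)) inferInstance

instance : MeasurableSpace (AffineGrassmannian n k) := borel _

instance : BorelSpace (AffineGrassmannian n k) := ⟨rfl⟩

/-- The affine subspace `z + E`. -/
def mk (E : Grassmannian n k) (z : Space n) : AffineGrassmannian n k :=
  ⟨AffineSubspace.mk' z E.1, AffineSubspace.mk'_nonempty z E.1, by
    rw [AffineSubspace.direction_mk']; exact E.2⟩

/-- The rigid-motion invariant measure `ν_{n,k}` on `M_{n,k}`: the mixture over `E ∼ μ_{n,k}` of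
the laws of `x + E` for `x` distributed according to Lebesgue measure on `E^⊥`, so that
`ν_{n,k}(A) = ∫ |{x ∈ E^⊥ : x + E ∈ A}| dμ_{n,k}(E)` (see `measure_apply`). -/
def measure (h : k ≤ n) : Measure (AffineGrassmannian n k) :=
  (Grassmannian.haar h).bind fun E => (volume : Measure E.1ᗮ).map fun x : E.1ᗮ => mk E (x : Space n)

lemma dir_mk (E : Grassmannian n k) (z : Space n) : (mk E z).dir = E :=
  Subtype.ext (AffineSubspace.direction_mk' z E.1)

lemma foot_mk (E : Grassmannian n k) (z : Space n) :
    (mk E z).foot = z - Grassmannian.proj E z := by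
  have : Nonempty (mk E z).1 := (mk E z).2.1.to_subtype
  have h := EuclideanGeometry.inter_eq_singleton_orthogonalProjection
    (s := (mk E z).1) (0 : Space n)
  have hd : (mk E z).1.direction = E.1 := AffineSubspace.direction_mk' z E.1
  have hm : z - Grassmannian.proj E z ∈ ((mk E z).1 : Set (Space n)) ∩
      AffineSubspace.mk' (0 : Space n) (mk E z).1.directionᗮ := by
    rw [hd]
    refine ⟨?_, ?_⟩
    · change _ ∈ AffineSubspace.mk' z E.1
      simp [AffineSubspace.mem_mk', Grassmannian.proj]
    · simp only [SetLike.mem_coe, AffineSubspace.mem_mk', vsub_eq_sub, sub_zero]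
      exact Submodule.sub_starProjection_mem_orthogonal z
  rw [h] at hm
  exact hm.symm

lemma measurable_mk :
    Measurable fun q : Grassmannian n k × Space n => mk q.1 q.2 := by
  refine measurable_of_isOpen fun s hs => ?_
  obtain ⟨t, ht, rfl⟩ := isOpen_induced_iff.1 hs
  have hc : Continuous fun q : Grassmannian n k × Space n => (q.1, q.2 - q.1.proj q.2) :=
    continuous_fst.prodMk (continuous_snd.sub
      ((Grassmannian.continuous_proj.comp continuous_fst).clm_apply continuous_snd))
  have he : (fun q : Grassmannian n k × Space n => ((mk q.1 q.2).dir, (mk q.1 q.2).foot)) =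
      fun q => (q.1, q.2 - q.1.proj q.2) := by
    ext1 q
    rw [dir_mk, foot_mk]
  change MeasurableSet
    ((fun q : Grassmannian n k × Space n => ((mk q.1 q.2).dir, (mk q.1 q.2).foot)) ⁻¹' t)
  rw [he]
  exact (ht.preimage hc).measurableSet

/-- Lebesgue measure of the fibre `{x ∈ E^⊥ : x + E ∈ A}` depends measurably on `E`. -/
lemma measurable_volume_fibre {A : Set (AffineGrassmannian n k)} (hA : MeasurableSet A) :
    Measurable fun E : Grassmannian n k => volume {x : E.1ᗮ | mk E (x : Space n) ∈ A} := by
  have : SecondCountableTopology (Grassmannian n k) :=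
    TopologicalSpace.secondCountableTopology_induced _ _ Grassmannian.proj
  set c : ℝ≥0∞ := volume (Metric.closedBall (0 : EuclideanSpace ℝ (Fin k)) 1) with hc
  have hc0 : c ≠ 0 := (Metric.measure_closedBall_pos _ _ one_pos).ne'
  have hct : c ≠ ⊤ := measure_closedBall_lt_top.ne
  have hS : MeasurableSet {q : Grassmannian n k × Space n | ‖q.1.proj q.2‖ ≤ 1 ∧ mk q.1 q.2 ∈ A} :=
    (measurableSet_le
      ((Grassmannian.continuous_proj.comp continuous_fst).clm_apply
        continuous_snd).norm.measurable measurable_const).inter (measurable_mk hA)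
  have hm := measurable_measure_prodMk_left (ν := (volume : Measure (Space n))) hS
  have key : ∀ E : Grassmannian n k,
      volume {x : E.1ᗮ | mk E (x : Space n) ∈ A} = c⁻¹ * volume (Prod.mk E ⁻¹'
        {q : Grassmannian n k × Space n | ‖q.1.proj q.2‖ ≤ 1 ∧ mk q.1 q.2 ∈ A}) := by
    intro E
    have hb : volume (Metric.closedBall (0 : E.1) 1) = c := by
      let b := (stdOrthonormalBasis ℝ E.1).reindex (finCongr E.2)
      have := b.measurePreserving_repr.measure_preimage
        (s := Metric.closedBall (0 : EuclideanSpace ℝ (Fin k)) 1)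
        Metric.isClosed_closedBall.measurableSet.nullMeasurableSet
      rw [hc, ← this]
      congr 1
      ext x
      simp
    have hp := (E.1.measurePreserving_measurableEquivProd (0 : Space n)).measure_preimage_equiv
      (Metric.closedBall (0 : E.1) 1 ×ˢ {x : E.1ᗮ | mk E (x : Space n) ∈ A})
    rw [Measure.volume_eq_prod, Measure.prod_prod, hb,
      InnerProductSpace.euclideanHausdorffMeasure_eq_volume] at hp
    rw [← ENNReal.mul_right_inj hc0 hct, ← hp, ← mul_assoc, ENNReal.mul_inv_cancel hc0 hct, one_mul]
    congr 1
    ext z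
    have hz : mk E (z - E.1.starProjection z) = mk E z := by
      refine Subtype.ext (AffineSubspace.ext fun y => ?_)
      change y ∈ AffineSubspace.mk' _ _ ↔ y ∈ AffineSubspace.mk' _ _
      simp only [AffineSubspace.mem_mk', vsub_eq_sub]
      rw [show y - (z - E.1.starProjection z) = (y - z) + E.1.starProjection z by abel]
      exact E.1.add_mem_iff_left (E.1.starProjection_apply_mem z)
    simp [hz, Grassmannian.proj]
  simp_rw [key]
  exact hm.const_mul _

lemma measurable_kernel : Measurable fun E : Grassmannian n k =>
    (volume : Measure E.1ᗮ).map fun x : E.1ᗮ => mk E (x : Space n) := by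
  refine Measure.measurable_of_measurable_coe _ fun A hA => ?_
  convert measurable_volume_fibre hA using 2 with E
  exact Measure.map_apply (measurable_mk.comp
    (measurable_const.prodMk measurable_subtype_coe)) hA

lemma measure_apply (h : k ≤ n) {A : Set (AffineGrassmannian n k)} (hA : MeasurableSet A) :
    measure h A =
      ∫⁻ E, volume {x : E.1ᗮ | mk E (x : Space n) ∈ A} ∂(Grassmannian.haar h) := by
  rw [measure, Measure.bind_apply hA measurable_kernel.aemeasurable]
  refine lintegral_congr fun E => ?_
  exact Measure.map_apply (measurable_mk.comp
    (measurable_const.prodMk measurable_subtype_coe)) hA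

end AffineGrassmannian

/-! ### The functional -/

/-- The norm `‖f|_F‖_p = (∫_F |f|^p)^{1/p} ∈ [0, ∞]` with respect to `k`-dimensional Lebesgue
measure on the affine subspace `F`. -/
def planeNorm {n k : ℕ} {𝕜 : Type*} [RCLike 𝕜] (f : Space n → 𝕜) (p : ℝ)
    (F : AffineGrassmannian n k) : ℝ≥0∞ :=
  eLpNorm' ((F.1 : Set (Space n)).domRestrict f) p (Measure.euclideanHausdorffMeasure k)

/-- The functional `∫_{M_{n,k}} ∏ᵢ ‖fᵢ|_F‖_{pᵢ}^{αᵢ} dν_{n,k}(F)`, with the conventions of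
`[0, ∞]`: `0 ^ a = ∞` and `∞ ^ a = 0` for `a < 0`, and `0 * ∞ = 0`. -/
def affineFunctional {n k m : ℕ} (h : k ≤ n) {𝕜 : Type*} [RCLike 𝕜] (p α : Fin m → ℝ)
    (f : Fin m → Space n → 𝕜) : ℝ≥0∞ :=
  ∫⁻ F, ∏ i, planeNorm (f i) (p i) F ^ α i ∂(AffineGrassmannian.measure h)

end AffineGrass

end

noncomputable section

namespace AffineGrass

/-! The proof is a change of variables `F ↦ g F` on the affine Grassmannian. Let `A` be the linear
part of `g`, so `|det A| = 1`, and let `J` be the factor by which `A` scales `k`-dimensional volume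
on the direction `E` of `F`. It is positive and depends only on `E`. Transporting `fᵢ` from `F` to
`g F` multiplies its norm by `J ^ (1 / pᵢ)`, so the product of the powers gains `J ^ (∑ αᵢ / pᵢ) = J
^ (n + 1)` (`prod_planeNorm_map`). It remains to see that `g` pushes `J ^ (-(n + 1)) ν` forward to
`ν` (`map_withDensity_jacDensity`).

One factor of the density comes from the fibres. Since `g` preserves `n`-dimensional volume and
scales `E` by `J`, it scales the translates of `E`, parametrised by the orthogonal complement, by `1
/ J` (`volume_fibre_map`).

The other `n` factors come from the linear Grassmannian (`lintegral_map_haar`). Up to a constant,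
Haar measure is the law of the span of a random `X : ℝᵏ → ℝⁿ` in the unit ball, because that law is
rotation invariant and such measures are proportional. The substitution `X ↦ A X` preserves Lebesgue
measure, but replaces the ball by another body. The functions integrated against it depend only on
the span of `X`, so only the weight of the body on each orbit of right multiplication by `GL_k`
matters. That weight is `normDet (A X) ^ (-n)` in place of `normDet X ^ (-n)`, up to a common
constant, and the ratio is `J ^ (-n)`. -/

/-- Linear maps `ℝᵏ → ℝⁿ`. -/
abbrev Hom (k n : ℕ) : Type := Space k →L[ℝ] Space n

/-! ### Determinants of composition operators on `Hom k n`. -/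

section DetComp

variable {k n : ℕ}

/-- Postcomposition with `A`, as a linear endomorphism of `Hom k n`. -/
def postcomp (k : ℕ) {n : ℕ} (A : Hom n n) : Hom k n →ₗ[ℝ] Hom k n where
  toFun X := A.comp X
  map_add' X Y := by simp
  map_smul' c X := by simp

/-- Precomposition with `T`, as a linear endomorphism of `Hom k n`. -/
def precomp {k : ℕ} (n : ℕ) (T : Hom k k) : Hom k n →ₗ[ℝ] Hom k n where
  toFun X := X.comp T
  map_add' X Y := by simp
  map_smul' c X := by simp

/-- In terms of the `k` columns of `X`, postcomposition applies `A` to each column separately. -/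
lemma det_postcomp (A : Hom n n) : LinearMap.det (postcomp k A) = A.det ^ k := by
  let e : Hom k n ≃ₗ[ℝ] (Fin k → Space n) :=
    LinearMap.toContinuousLinearMap.symm.trans
      ((EuclideanSpace.basisFun (Fin k) ℝ).toBasis.constr ℝ).symm
  rw [← LinearMap.det_conj (postcomp k A) e]
  have : (e : Hom k n →ₗ[ℝ] _) ∘ₗ postcomp k A ∘ₗ (e.symm : (Fin k → Space n) →ₗ[ℝ] _) =
      LinearMap.pi fun i => A.toLinearMap.comp (LinearMap.proj i) := by
    refine LinearMap.ext fun v => funext fun i => ?_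
    have h : ∀ X : Hom k n, ∀ i, e X i = X (EuclideanSpace.basisFun (Fin k) ℝ i) := by
      intro X i
      rfl
    simp only [LinearMap.comp_apply, LinearEquiv.coe_coe, h, LinearMap.pi_apply,
      LinearMap.proj_apply, postcomp, LinearMap.coe_mk, AddHom.coe_mk,
      ContinuousLinearMap.comp_apply]
    rw [← h, LinearEquiv.apply_symm_apply]
    rfl
  rw [this, LinearMap.det_pi]
  simp [ContinuousLinearMap.det]

/-- In terms of the `n` rows of `X`, viewed as functionals on `ℝᵏ`, precomposition applies the
transpose of `T` to each row. -/
lemma det_precomp (T : Hom k k) : LinearMap.det (precomp n T) = T.det ^ n := by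
  let e : Hom k n ≃ₗ[ℝ] (Fin n → Module.Dual ℝ (Space k)) :=
    { toFun := fun X i => (EuclideanSpace.proj i : Space n →L[ℝ] ℝ).toLinearMap ∘ₗ X.toLinearMap
      map_add' := fun X Y => by ext; simp
      map_smul' := fun c X => by ext; simp
      invFun := fun φ => LinearMap.toContinuousLinearMap
        ((WithLp.linearEquiv 2 ℝ (Fin n → ℝ)).symm.toLinearMap ∘ₗ LinearMap.pi φ)
      left_inv := fun X => by ext; simp
      right_inv := fun φ => by ext; simp }
  rw [← LinearMap.det_conj (precomp n T) e]
  have : (e : Hom k n →ₗ[ℝ] _) ∘ₗ precomp n T ∘ₗ (e.symm : (Fin n → _) →ₗ[ℝ] _) =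
      LinearMap.pi fun i => T.toLinearMap.dualMap.comp (LinearMap.proj i) := by
    refine LinearMap.ext fun φ => funext fun i => LinearMap.ext fun y => ?_
    have h : e (e.symm φ) i (T y) = φ i (T y) := by rw [e.apply_symm_apply]
    exact h
  rw [this, LinearMap.det_pi]
  simp [ContinuousLinearMap.det, LinearMap.det_dualMap]

end DetComp

/-! ### Lebesgue measure on `Hom k n` and the invariant measure of `GL_k`. -/

section HomMeasure

variable {k n : ℕ}

instance : MeasureSpace (Hom k n) := ⟨Measure.addHaar⟩

instance : (volume : Measure (Hom k n)).IsAddHaarMeasure :=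
  inferInstanceAs (Measure.addHaar : Measure (Hom k n)).IsAddHaarMeasure

lemma lintegral_comp_linearMap (L : Hom k n →ₗ[ℝ] Hom k n) (hL : LinearMap.det L ≠ 0)
    {f : Hom k n → ℝ≥0∞} (hf : Measurable f) :
    ∫⁻ X, f (L X) = ENNReal.ofReal |LinearMap.det L|⁻¹ * ∫⁻ X, f X := by
  have hLm : Measurable L := L.continuous_of_finiteDimensional.measurable
  rw [← lintegral_map hf hLm, Measure.map_linearMap_addHaar_eq_smul_addHaar volume hL,
    lintegral_smul_measure, abs_inv, smul_eq_mul]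

lemma lintegral_comp_left (A : Hom n n) (hA : A.det ≠ 0) {f : Hom k n → ℝ≥0∞}
    (hf : Measurable f) :
    ∫⁻ X : Hom k n, f (A.comp X) = (ENNReal.ofReal (|A.det| ^ k))⁻¹ * ∫⁻ X, f X := by
  have h := lintegral_comp_linearMap (postcomp k A) (by rw [det_postcomp]; positivity) hf
  rw [det_postcomp, abs_pow, ENNReal.ofReal_inv_of_pos (by positivity)] at h
  exact h

lemma lintegral_comp_right (T : Hom k k) (hT : T.det ≠ 0) {f : Hom k n → ℝ≥0∞}
    (hf : Measurable f) :
    ∫⁻ X : Hom k n, f (X.comp T) = (ENNReal.ofReal (|T.det| ^ n))⁻¹ * ∫⁻ X, f X := by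
  have h := lintegral_comp_linearMap (precomp n T) (by rw [det_precomp]; positivity) hf
  rw [det_precomp, abs_pow, ENNReal.ofReal_inv_of_pos (by positivity)] at h
  exact h

/-- The invariant measure `|det T|⁻ᵏ dT` on the invertible endomorphisms of `ℝᵏ`. -/
def glHaar (k : ℕ) : Measure (Hom k k) :=
  volume.withDensity fun T => {T : Hom k k | T.det ≠ 0}.indicator
    (fun T => (ENNReal.ofReal (|T.det| ^ k))⁻¹) T

lemma continuous_det : Continuous fun T : Hom k k => T.det :=
  ContinuousLinearMap.continuous_det

lemma measurableSet_det_ne_zero : MeasurableSet {T : Hom k k | T.det ≠ 0} :=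
  (isOpen_ne_fun continuous_det continuous_const).measurableSet

lemma measurable_det_pow (k m : ℕ) : Measurable fun T : Hom k k => ENNReal.ofReal (|T.det| ^ m) :=
  (continuous_det.abs.pow m).measurable.ennreal_ofReal

lemma measurable_glHaar_density : Measurable fun T => {T : Hom k k | T.det ≠ 0}.indicator
    (fun T => (ENNReal.ofReal (|T.det| ^ k))⁻¹) T :=
  (measurable_det_pow k k).inv.indicator measurableSet_det_ne_zero

instance : SFinite (glHaar k) := by unfold glHaar; infer_instance

lemma lintegral_glHaar {f : Hom k k → ℝ≥0∞} (hf : Measurable f) :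
    ∫⁻ T, f T ∂(glHaar k) = ∫⁻ T, {T : Hom k k | T.det ≠ 0}.indicator
      (fun T => (ENNReal.ofReal (|T.det| ^ k))⁻¹) T * f T := by
  rw [glHaar, lintegral_withDensity_eq_lintegral_mul _ measurable_glHaar_density hf]
  rfl

lemma lintegral_glHaar_congr {f g : Hom k k → ℝ≥0∞} (h : ∀ T : Hom k k, T.det ≠ 0 → f T = g T) :
    ∫⁻ T, f T ∂(glHaar k) = ∫⁻ T, g T ∂(glHaar k) := by
  refine lintegral_congr_ae ?_
  rw [Filter.EventuallyEq, glHaar, ae_withDensity_iff measurable_glHaar_density]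
  refine ae_of_all _ fun T hT => h T ?_
  by_contra h0
  exact hT (Set.indicator_of_notMem (by simpa using h0) _)

lemma det_comp' (S T : Hom k k) : (S.comp T).det = S.det * T.det :=
  LinearMap.det_comp _ _

/-- Common source of left and right invariance: the Jacobian `|d| ^ k` of `L` is cancelled by the
change of the density `|det T| ^ (-k)`. -/
lemma lintegral_glHaar_of_scale (L : Hom k k →ₗ[ℝ] Hom k k) {d : ℝ} (hd : d ≠ 0)
    (hL : |LinearMap.det L| = |d| ^ k) (hdet : ∀ T : Hom k k, (L T).det = d * T.det)
    {f : Hom k k → ℝ≥0∞} (hf : Measurable f) :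
    ∫⁻ T, f (L T) ∂(glHaar k) = ∫⁻ T, f T ∂(glHaar k) := by
  have hd' : 0 < |d| ^ k := by positivity
  have hLm : Measurable L := L.continuous_of_finiteDimensional.measurable
  rw [lintegral_glHaar hf, lintegral_glHaar (f := fun T => f (L T)) (hf.comp hLm)]
  have h := lintegral_comp_linearMap L (by rw [← abs_pos, hL]; exact hd')
    (measurable_glHaar_density.mul hf)
  rw [hL, ENNReal.ofReal_inv_of_pos hd'] at h
  have hne : ENNReal.ofReal (|d| ^ k) ≠ 0 := (ENNReal.ofReal_pos.2 hd').ne'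
  have h2 : ∫⁻ T, {T : Hom k k | T.det ≠ 0}.indicator
      (fun T => (ENNReal.ofReal (|T.det| ^ k))⁻¹) T * f T = ENNReal.ofReal (|d| ^ k) *
      ∫⁻ T, {T : Hom k k | T.det ≠ 0}.indicator
      (fun T => (ENNReal.ofReal (|T.det| ^ k))⁻¹) (L T) * f (L T) := by
    simp only [Pi.mul_apply] at h
    rw [h, ← mul_assoc, ENNReal.mul_inv_cancel hne ENNReal.ofReal_ne_top, one_mul]
  rw [h2, ← lintegral_const_mul' _ _ ENNReal.ofReal_ne_top]
  refine lintegral_congr fun T => ?_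
  rw [← mul_assoc]
  congr 1
  by_cases hT : T.det = 0
  · simp [hT, hdet]
  · have h1 : T ∈ {T : Hom k k | T.det ≠ 0} := hT
    have h3 : L T ∈ {T : Hom k k | T.det ≠ 0} := by
      change (L T).det ≠ 0
      rw [hdet]; exact mul_ne_zero hd hT
    rw [Set.indicator_of_mem h1, Set.indicator_of_mem h3, hdet, abs_mul, mul_pow,
      ENNReal.ofReal_mul hd'.le, ENNReal.mul_inv (Or.inl hne) (Or.inl ENNReal.ofReal_ne_top),
      ← mul_assoc, ENNReal.mul_inv_cancel hne ENNReal.ofReal_ne_top, one_mul]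

lemma lintegral_glHaar_comp_left (S : Hom k k) (hS : S.det ≠ 0) {f : Hom k k → ℝ≥0∞}
    (hf : Measurable f) : ∫⁻ T, f (S.comp T) ∂(glHaar k) = ∫⁻ T, f T ∂(glHaar k) :=
  lintegral_glHaar_of_scale (postcomp k S) hS (by rw [det_postcomp, abs_pow])
    (fun T => det_comp' S T) hf

lemma lintegral_glHaar_comp_right (S : Hom k k) (hS : S.det ≠ 0) {f : Hom k k → ℝ≥0∞}
    (hf : Measurable f) : ∫⁻ T, f (T.comp S) ∂(glHaar k) = ∫⁻ T, f T ∂(glHaar k) :=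
  lintegral_glHaar_of_scale (precomp k S) hS (by rw [det_precomp, abs_pow])
    (fun T => (det_comp' T S).trans (mul_comm _ _)) hf

end HomMeasure

/-! ### Volume factors of linear maps and the open set of injective maps. -/

section NormDet

variable {k n : ℕ}

/-- The square of `normDet X` is the Gram determinant `det (X* X)`, which is continuous in `X`. -/
lemma continuous_normDet : Continuous fun X : Hom k n => X.toLinearMap.normDet := by
  have h : (fun X : Hom k n => X.toLinearMap.normDet) =
      fun X : Hom k n => Real.sqrt ((ContinuousLinearMap.adjoint X).comp X).det := by
    ext1 X
    have := X.normDet_sq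
    rw [← Real.sqrt_sq X.toLinearMap.normDet_nonneg]
    congr 1
  rw [h]
  exact Real.continuous_sqrt.comp (continuous_det.comp
    (((ContinuousLinearMap.adjoint : Hom k n ≃ₗᵢ⋆[ℝ] Hom n k).continuous).clm_comp continuous_id))

lemma normDet_ne_zero_iff (X : Hom k n) :
    X.toLinearMap.normDet ≠ 0 ↔ Function.Injective X := by
  rw [Ne, LinearMap.normDet_eq_zero_iff_ker_ne_bot, not_not, LinearMap.ker_eq_bot]
  rfl

lemma normDet_pos {X : Hom k n} (hX : Function.Injective X) : 0 < X.toLinearMap.normDet :=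
  lt_of_le_of_ne X.toLinearMap.normDet_nonneg ((normDet_ne_zero_iff X).2 hX).symm

lemma det_ne_zero_iff (S : Hom k k) : S.det ≠ 0 ↔ Function.Injective S := by
  rw [← normDet_ne_zero_iff, LinearMap.normDet_eq_abs_det, abs_ne_zero]

lemma isOpen_injective : IsOpen {X : Hom k n | Function.Injective X} := by
  simp_rw [← normDet_ne_zero_iff]
  exact isOpen_ne_fun continuous_normDet continuous_const

lemma adjoint_comp_isometry (Q : Space k →ₗᵢ[ℝ] Space n) :
    (ContinuousLinearMap.adjoint Q.toContinuousLinearMap).comp Q.toContinuousLinearMap = 1 := by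
  rw [← ContinuousLinearMap.norm_map_iff_adjoint_comp_self]
  exact Q.norm_map

lemma isUnit_adjoint_comp {X : Hom k n} (hX : Function.Injective X) :
    IsUnit ((ContinuousLinearMap.adjoint X).comp X) := by
  rw [ContinuousLinearMap.isUnit_iff_bijective]
  have hi : Function.Injective ((ContinuousLinearMap.adjoint X).comp X) := by
    rw [← det_ne_zero_iff]
    have h := X.normDet_sq
    have h2 := (normDet_pos hX)
    intro h0
    rw [h0] at h
    have : X.toLinearMap.normDet ^ 2 = 0 := h
    exact h2.ne' (pow_eq_zero_iff two_ne_zero |>.1 this)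
  exact ⟨hi, (LinearMap.injective_iff_surjective
    (f := ((ContinuousLinearMap.adjoint X).comp X).toLinearMap)).1 hi⟩

end NormDet

/-! ### Subspaces as spans of frames, and transitivity of the orthogonal group. -/

namespace Grassmannian

variable {k n : ℕ}

instance : SecondCountableTopology (Grassmannian n k) :=
  TopologicalSpace.secondCountableTopology_induced _ _ Grassmannian.proj

lemma injective_proj : Function.Injective (proj : Grassmannian n k → _) := by
  intro E E' h
  refine Subtype.ext ?_
  rw [← Submodule.range_starProjection E.1, ← Submodule.range_starProjection E'.1]
  exact congrArg (fun f : Space n →L[ℝ] Space n => LinearMap.range f.toLinearMap) h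

instance : T2Space (Grassmannian n k) :=
  T2Space.of_injective_continuous injective_proj continuous_proj

/-- An isometric parametrisation of a subspace. -/
lemma exists_frame (E : Grassmannian n k) :
    ∃ Q : Space k →ₗᵢ[ℝ] Space n, LinearMap.range Q.toLinearMap = E.1 := by
  let b := (stdOrthonormalBasis ℝ E.1).reindex (finCongr E.2)
  refine ⟨E.1.subtypeₗᵢ.comp b.repr.symm.toLinearIsometry, ?_⟩
  ext x
  constructor
  · rintro ⟨y, rfl⟩
    exact (b.repr.symm y).2
  · intro hx
    exact ⟨b.repr ⟨x, hx⟩, by simp⟩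

lemma proj_of_frame (E : Grassmannian n k) (Q : Space k →ₗᵢ[ℝ] Space n)
    (hQ : LinearMap.range Q.toLinearMap = E.1) (x : Space n) :
    proj E x = Q (ContinuousLinearMap.adjoint Q.toContinuousLinearMap x) := by
  refine Submodule.eq_starProjection_of_mem_of_inner_eq_zero (K := E.1) ?_ ?_
  · rw [← hQ]; exact ⟨_, rfl⟩
  · intro w hw
    rw [← hQ] at hw
    obtain ⟨y, rfl⟩ := hw
    have h1 : inner ℝ (Q (ContinuousLinearMap.adjoint Q.toContinuousLinearMap x)) (Q y) =
      inner ℝ (ContinuousLinearMap.adjoint Q.toContinuousLinearMap x) y := Q.inner_map_map _ _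
    have h2 := ContinuousLinearMap.adjoint_inner_left Q.toContinuousLinearMap y x
    rw [inner_sub_left]
    refine sub_eq_zero.2 ?_
    exact (h1.trans h2).symm

/-- The image of a subspace under an invertible linear map. -/
def map (A : Space n ≃L[ℝ] Space n) (E : Grassmannian n k) : Grassmannian n k :=
  ⟨E.1.map A.toLinearEquiv.toLinearMap, by rw [LinearEquiv.finrank_map_eq]; exact E.2⟩

/-- The factor by which `A` scales the `k`-dimensional volume of `E`. -/
def jac (A : Space n ≃L[ℝ] Space n) (E : Grassmannian n k) : ℝ :=
  (A.toLinearEquiv.toLinearMap.domRestrict E.1).normDet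

lemma jac_pos (A : Space n ≃L[ℝ] Space n) (E : Grassmannian n k) : 0 < jac A E := by
  refine lt_of_le_of_ne (LinearMap.normDet_nonneg _) (Ne.symm ?_)
  rw [jac, Ne, LinearMap.normDet_eq_zero_iff_ker_ne_bot, not_not, LinearMap.ker_eq_bot]
  exact A.injective.comp Subtype.val_injective

/-- The range of an injective linear map `ℝᵏ → ℝⁿ`. -/
def ofInjective (X : Hom k n) (hX : Function.Injective X) : Grassmannian n k :=
  ⟨LinearMap.range X.toLinearMap, by rw [LinearMap.finrank_range_of_inj hX]; simp⟩

open Classical in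
/-- The range of `X`, if it has dimension `k`. -/
def span (h : k ≤ n) (X : Hom k n) : Grassmannian n k :=
  -- The default value `coord h` is harmless: the integrands built from `span` are cut off to
  -- injective `X`.
  if hX : Function.Injective X then ofInjective X hX else coord h

variable (h : k ≤ n)

lemma coe_span {X : Hom k n} (hX : Function.Injective X) :
    (span h X).1 = LinearMap.range X.toLinearMap := by
  rw [span, dif_pos hX]
  rfl

lemma span_comp_right {X : Hom k n} (hX : Function.Injective X) {T : Hom k k} (hT : T.det ≠ 0) :
    span h (X.comp T) = span h X := by
  have hi := (det_ne_zero_iff T).1 hT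
  have hs := (LinearMap.injective_iff_surjective (f := T.toLinearMap)).1 hi
  refine Subtype.ext ?_
  rw [coe_span h hX, coe_span h (X := X.comp T) (hX.comp hi)]
  exact LinearMap.range_comp_of_range_eq_top _ (LinearMap.range_eq_top.2 hs)

lemma span_comp_left {X : Hom k n} (hX : Function.Injective X) (A : Space n ≃L[ℝ] Space n) :
    span h ((A : Hom n n).comp X) = map A (span h X) := by
  refine Subtype.ext ?_
  rw [coe_span h (X := (A : Hom n n).comp X) (A.injective.comp hX)]
  change _ = (span h X).1.map _
  rw [coe_span h hX]
  exact LinearMap.range_comp _ _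

lemma normDet_comp_left {X : Hom k n} (hX : Function.Injective X) (A : Space n ≃L[ℝ] Space n) :
    ((A : Hom n n).comp X).toLinearMap.normDet = jac A (span h X) * X.toLinearMap.normDet := by
  have := LinearMap.normDet_comp X.toLinearMap A.toLinearEquiv.toLinearMap
  have hE : span h X = ofInjective X hX := by rw [span, dif_pos hX]
  rw [hE]
  exact this

/-- Take `S = Q* X` with `Q` an isometric frame of the range of `X`. Integrals over `GL_k` orbits in
`Hom k n` thereby reduce to `Hom k k`. -/
lemma exists_polar {X : Hom k n} (hX : Function.Injective X) :
    ∃ (Q : Space k →ₗᵢ[ℝ] Space n) (S : Hom k k), S.det ≠ 0 ∧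
      X = Q.toContinuousLinearMap.comp S ∧ LinearMap.range Q.toLinearMap = (span h X).1 := by
  obtain ⟨Q, hQ⟩ := exists_frame (span h X)
  have hXS : X = Q.toContinuousLinearMap.comp
      ((ContinuousLinearMap.adjoint Q.toContinuousLinearMap).comp X) := by
    ext1 x
    refine Eq.trans ?_ (proj_of_frame _ Q hQ (X x))
    refine (Submodule.starProjection_eq_self_iff.2 ?_).symm
    rw [coe_span h hX]
    exact ⟨x, rfl⟩
  refine ⟨Q, (ContinuousLinearMap.adjoint Q.toContinuousLinearMap).comp X, ?_, hXS, hQ⟩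
  rw [det_ne_zero_iff]
  rw [hXS] at hX
  exact Function.Injective.of_comp hX

/-- The least squares formula `X (X* X)⁻¹ X*`. It makes the continuity of `span` on injective maps
visible. -/
lemma proj_span {X : Hom k n} (hX : Function.Injective X) :
    proj (span h X) = X.comp ((Ring.inverse ((ContinuousLinearMap.adjoint X).comp X)).comp
      (ContinuousLinearMap.adjoint X)) := by
  ext1 x
  refine Submodule.eq_starProjection_of_mem_of_inner_eq_zero (K := (span h X).1) ?_ ?_
  · rw [coe_span h hX]; exact ⟨_, rfl⟩
  · intro w hw
    rw [coe_span h hX] at hw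
    obtain ⟨y, rfl⟩ := hw
    have hu := Ring.mul_inverse_cancel _ (isUnit_adjoint_comp hX)
    have h1 := congrArg (fun f : Hom k k => f (ContinuousLinearMap.adjoint X x)) hu
    have h2 := ContinuousLinearMap.adjoint_inner_left X y
      (x - X (Ring.inverse ((ContinuousLinearMap.adjoint X).comp X)
        (ContinuousLinearMap.adjoint X x)))
    refine h2.symm.trans ?_
    rw [map_sub]
    have h3 : ContinuousLinearMap.adjoint X x = ContinuousLinearMap.adjoint X
      (X (Ring.inverse ((ContinuousLinearMap.adjoint X).comp X)
        (ContinuousLinearMap.adjoint X x))) := h1.symm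
    rw [← h3, sub_self, inner_zero_left]

lemma continuousOn_span : ContinuousOn (span h) {X : Hom k n | Function.Injective X} := by
  have hadj := (ContinuousLinearMap.adjoint : Hom k n ≃ₗᵢ⋆[ℝ] Hom n k).continuous
  rw [continuousOn_iff_continuous_domRestrict]
  refine continuous_induced_rng.2 ?_
  have : proj ∘ ({X : Hom k n | Function.Injective X}.domRestrict (span h)) =
      fun X : {X : Hom k n | Function.Injective X} => X.1.comp
      ((Ring.inverse ((ContinuousLinearMap.adjoint X.1).comp X.1)).comp
      (ContinuousLinearMap.adjoint X.1)) := funext fun X => proj_span h X.2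
  rw [this]
  refine continuous_subtype_val.clm_comp (Continuous.clm_comp ?_ (hadj.comp continuous_subtype_val))
  refine continuous_iff_continuousAt.2 fun X => ?_
  obtain ⟨u, hu⟩ := isUnit_adjoint_comp X.2
  refine ContinuousAt.comp (g := Ring.inverse) ?_
    ((hadj.comp continuous_subtype_val).clm_comp continuous_subtype_val).continuousAt
  rw [← hu]
  exact NormedRing.inverse_continuousAt u

lemma measurable_span : Measurable (span h : Hom k n → _) := by
  classical
  have := ContinuousOn.measurable_piecewise (continuousOn_span h)
    (continuousOn_const (c := coord h)) isOpen_injective.measurableSet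
  convert this using 1
  ext1 X
  by_cases hX : Function.Injective X
  · rw [Set.piecewise_eq_of_mem _ _ _ hX]
  · rw [Set.piecewise_eq_of_notMem _ _ _ hX, span, dif_neg hX]

/-- `O(n)` acts transitively on the Grassmannian. -/
lemma exists_rotate_eq (E : Grassmannian n k) : ∃ U, rotate U (coord h) = E := by
  obtain ⟨Q, hQ⟩ := exists_frame (coord h)
  obtain ⟨R, hR⟩ := exists_frame E
  -- `R ∘ Q⁻¹` carries the coordinate subspace isometrically onto `E`; its isometric extension to
  -- `ℝⁿ` is the required rotation.
  let L : LinearMap.range Q.toLinearMap →ₗᵢ[ℝ] Space n :=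
    R.comp Q.equivRange.symm.toLinearIsometry
  let M : Matrix (Fin n) (Fin n) ℝ :=
    (Matrix.toEuclideanCLM (n := Fin n) (𝕜 := ℝ)).symm L.extend.toContinuousLinearMap
  have hM : M ∈ Matrix.orthogonalGroup (Fin n) ℝ := by
    rw [Matrix.mem_orthogonalGroup_iff']
    have h1 := adjoint_comp_isometry L.extend
    have h2 : star M = Matrix.transpose M := by ext; simp [Matrix.star_apply]
    have h3 : Matrix.toEuclideanCLM (n := Fin n) (𝕜 := ℝ) M = L.extend.toContinuousLinearMap :=
      StarAlgEquiv.apply_symm_apply _ _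
    have h4 : Matrix.toEuclideanCLM (n := Fin n) (𝕜 := ℝ) (star M * M) =
        Matrix.toEuclideanCLM (n := Fin n) (𝕜 := ℝ) 1 := by
      rw [map_mul, map_star, h3, map_one]
      exact h1
    rw [← h2]
    exact (Matrix.toEuclideanCLM (n := Fin n) (𝕜 := ℝ)).injective h4
  refine ⟨⟨M, hM⟩, Subtype.ext ?_⟩
  have hact : ∀ x, orthAct ⟨M, hM⟩ x = L.extend x := by
    intro x
    rw [orthAct_apply]
    simp [M]
  simp only [rotate]
  rw [← hQ, ← hR]
  rw [← LinearMap.range_comp]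
  congr 1
  ext1 y
  refine (hact _).trans ?_
  have := L.extend_apply ⟨Q y, y, rfl⟩
  refine this.trans ?_
  change R (Q.equivRange.symm ⟨Q y, _⟩) = R y
  congr 1
  rw [LinearIsometryEquiv.symm_apply_eq]
  rfl

/-- A continuous surjection from a compact space to a Hausdorff space is a quotient map. Continuity
on the Grassmannian can therefore be tested on `O(n)`, where explicit frames exist. -/
lemma isQuotientMap_rotate : IsQuotientMap fun U => rotate U (coord h) :=
  (continuous_rotate (coord h)).isClosedMap.isQuotientMap (continuous_rotate _)
    fun E => exists_rotate_eq h E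

end Grassmannian

/-! ### The linear action on the Grassmannian, and uniqueness of the invariant measure. -/

namespace Grassmannian

variable {k n : ℕ} (h : k ≤ n)

lemma rotate_span {X : Hom k n} (hX : Function.Injective X) (U : OrthGroup n) :
    rotate U (span h X) =
      span h ((Matrix.toEuclideanCLM (n := Fin n) (𝕜 := ℝ) U.1).comp X) :=
  (span_comp_left h hX (orthAct U).toContinuousLinearEquiv).symm

lemma continuous_toEuclideanCLM : Continuous fun U : OrthGroup n =>
    (Matrix.toEuclideanCLM (n := Fin n) (𝕜 := ℝ) U.1 : Hom n n) := by
  have hc : Continuous (Matrix.toEuclideanCLM (n := Fin n) (𝕜 := ℝ)) :=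
    LinearMap.continuous_of_finiteDimensional
      (Matrix.toEuclideanCLM (n := Fin n) (𝕜 := ℝ)).toAlgEquiv.toLinearMap
  exact hc.comp (continuous_subtype_val (p := (· ∈ Matrix.orthogonalGroup (Fin n) ℝ)))

lemma exists_frame_rotate : ∃ Q : Space k →ₗᵢ[ℝ] Space n, ∀ U : OrthGroup n,
    rotate U (coord h) = span h ((Matrix.toEuclideanCLM (n := Fin n) (𝕜 := ℝ) U.1).comp
      Q.toContinuousLinearMap) := by
  obtain ⟨Q, hQ⟩ := exists_frame (coord h)
  refine ⟨Q, fun U => ?_⟩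
  rw [← rotate_span h (X := Q.toContinuousLinearMap) Q.injective]
  congr 1
  refine Subtype.ext ?_
  rw [coe_span h (X := Q.toContinuousLinearMap) Q.injective]
  exact hQ.symm

lemma injective_rotate_frame (Q : Space k →ₗᵢ[ℝ] Space n) (U : OrthGroup n) :
    Function.Injective ((Matrix.toEuclideanCLM (n := Fin n) (𝕜 := ℝ) U.1).comp
      Q.toContinuousLinearMap) :=
  (orthAct U).injective.comp Q.injective

lemma continuous_map (h : k ≤ n) (A : Space n ≃L[ℝ] Space n) :
    Continuous (map A : Grassmannian n k → Grassmannian n k) := by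
  rw [(isQuotientMap_rotate h).continuous_iff]
  obtain ⟨Q, hQ⟩ := exists_frame_rotate h
  have : (map A ∘ fun U => rotate U (coord h)) = fun U : OrthGroup n =>
      span h ((A : Hom n n).comp ((Matrix.toEuclideanCLM (n := Fin n) (𝕜 := ℝ) U.1).comp
      Q.toContinuousLinearMap)) := by
    ext1 U
    rw [span_comp_left h (injective_rotate_frame Q U), ← hQ]
    rfl
  rw [this]
  exact (continuousOn_span h).comp_continuous
    (continuous_const.clm_comp (continuous_toEuclideanCLM.clm_comp continuous_const))
    fun U => A.injective.comp (injective_rotate_frame Q U)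

lemma continuous_jac (h : k ≤ n) (A : Space n ≃L[ℝ] Space n) :
    Continuous (jac A : Grassmannian n k → ℝ) := by
  rw [(isQuotientMap_rotate h).continuous_iff]
  obtain ⟨Q, hQ⟩ := exists_frame_rotate h
  have : (jac A ∘ fun U => rotate U (coord h)) = fun U : OrthGroup n =>
      ((A : Hom n n).comp ((Matrix.toEuclideanCLM (n := Fin n) (𝕜 := ℝ) U.1).comp
      Q.toContinuousLinearMap)).toLinearMap.normDet := by
    ext1 U
    -- The frame `U Q` is isometric, so `jac A` at its span is simply `normDet (A U Q)`.
    have h1 := LinearIsometry.normDet_eq_one ((orthAct U).toLinearIsometry.comp Q)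
    have h2 := normDet_comp_left h (injective_rotate_frame Q U) A
    rw [h2, Function.comp, hQ]
    exact (mul_one _).symm.trans (congrArg _ h1.symm)
  rw [this]
  exact continuous_normDet.comp
    (continuous_const.clm_comp (continuous_toEuclideanCLM.clm_comp continuous_const))

lemma measurable_rotate_inv :
    Measurable fun q : OrthGroup n × Grassmannian n k => rotate q.1⁻¹ q.2 := by
  refine measurable_of_proj ?_
  simp only [proj_rotate]
  have h1 : Continuous fun q : OrthGroup n × Grassmannian n k =>
      (Matrix.toEuclideanCLM (n := Fin n) (𝕜 := ℝ) (q.1⁻¹).1 : Hom n n) :=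
    continuous_toEuclideanCLM.comp (continuous_fst.inv)
  have h2 : Continuous fun q : OrthGroup n × Grassmannian n k =>
      (Matrix.toEuclideanCLM (n := Fin n) (𝕜 := ℝ) (star (q.1⁻¹).1) : Hom n n) := by
    have : ∀ q : OrthGroup n × Grassmannian n k, star (q.1⁻¹).1 = q.1.1 := fun q => star_star _
    simp only [this]
    exact continuous_toEuclideanCLM.comp continuous_fst
  exact (h1.clm_comp ((continuous_proj.comp continuous_snd).clm_comp h2)).measurable

/-- By transitivity `E` is a rotated coordinate subspace, and left invariance of the Haar measure of
`O(n)` absorbs the rotation. -/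
lemma lintegral_orthHaar_rotate_inv {Φ : Grassmannian n k → ℝ≥0∞} (E : Grassmannian n k) :
    ∫⁻ U, Φ (rotate U⁻¹ E) ∂(orthHaar n) = ∫⁻ U, Φ (rotate U⁻¹ (coord h)) ∂(orthHaar n) := by
  obtain ⟨V, rfl⟩ := exists_rotate_eq h E
  have : (orthHaar n).IsMulLeftInvariant := by unfold orthHaar; infer_instance
  rw [← lintegral_mul_left_eq_self (μ := orthHaar n) (fun U => Φ (rotate U⁻¹ (coord h))) V⁻¹]
  refine lintegral_congr fun U => ?_
  rw [← rotate_mul, mul_inv_rev, inv_inv]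

/-- A rotation invariant measure on the Grassmannian is a multiple of `μ_{n,k}`. -/
lemma lintegral_eq_of_invariant (L : Measure (Grassmannian n k)) [SFinite L]
    (hL : ∀ U, L.map (rotate U) = L) {Φ : Grassmannian n k → ℝ≥0∞} (hΦ : Measurable Φ) :
    ∫⁻ E, Φ E ∂L = L univ * ∫⁻ E, Φ E ∂(haar h) := by
  have key : ∀ (M : Measure (Grassmannian n k)) [SFinite M], (∀ U, M.map (rotate U) = M) →
      ∫⁻ E, Φ E ∂M = (∫⁻ U, Φ (rotate U⁻¹ (coord h)) ∂(orthHaar n)) * M univ := by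
    intro M _ hM
    have h1 : ∀ U : OrthGroup n, ∫⁻ E, Φ (rotate U⁻¹ E) ∂M = ∫⁻ E, Φ E ∂M := fun U => by
      conv_rhs => rw [← hM U⁻¹, lintegral_map hΦ (measurable_rotate _)]
    -- Average the invariant integral over `U` and exchange the integrals: the inner average no
    -- longer depends on `E`, so only the total mass of `M` survives.
    calc ∫⁻ E, Φ E ∂M = ∫⁻ U, ∫⁻ E, Φ (rotate U⁻¹ E) ∂M ∂(orthHaar n) := by
          simp_rw [h1]; simp
      _ = ∫⁻ E, ∫⁻ U, Φ (rotate U⁻¹ E) ∂(orthHaar n) ∂M :=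
          lintegral_lintegral_swap (hΦ.comp measurable_rotate_inv).aemeasurable
      _ = _ := by
          simp_rw [lintegral_orthHaar_rotate_inv h]
          rw [lintegral_const]
  rw [key L hL, key (haar h) (map_rotate_haar h), measure_univ (μ := haar h), mul_one, mul_comm]

end Grassmannian

/-! ### Integration along the orbits of `GL_k` acting on `Hom k n` from the right. -/

variable {k n : ℕ}

lemma isUnit_of_det_ne_zero {T : Hom k k} (hT : T.det ≠ 0) : IsUnit T := by
  rw [ContinuousLinearMap.isUnit_iff_bijective]
  have hi := (det_ne_zero_iff T).1 hT
  exact ⟨hi, (LinearMap.injective_iff_surjective (f := T.toLinearMap)).1 hi⟩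

lemma det_one' : (1 : Hom k k).det = 1 := LinearMap.det_id

lemma det_inverse_mul {T : Hom k k} (hT : T.det ≠ 0) : (Ring.inverse T).det * T.det = 1 := by
  rw [← det_comp', ← det_one' (k := k)]
  exact congrArg _ (Ring.inverse_mul_cancel T (isUnit_of_det_ne_zero hT))

lemma continuousOn_inverse :
    ContinuousOn (Ring.inverse : Hom k k → Hom k k) {T | T.det ≠ 0} := by
  intro T hT
  obtain ⟨u, rfl⟩ := isUnit_of_det_ne_zero hT
  exact (NormedRing.inverse_continuousAt u).continuousWithinAt

lemma measurable_inverse : Measurable (Ring.inverse : Hom k k → Hom k k) := by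
  classical
  have := ContinuousOn.measurable_piecewise (continuousOn_inverse (k := k))
    (continuousOn_const (c := (0 : Hom k k))) measurableSet_det_ne_zero
  convert this using 1
  ext1 T
  by_cases hT : T.det ≠ 0
  · rw [Set.piecewise_eq_of_mem _ _ _ hT]
  · rw [Set.piecewise_eq_of_notMem _ _ _ hT, Ring.inverse_non_unit]
    intro hu
    have h1 := congrArg ContinuousLinearMap.det (Ring.inverse_mul_cancel T hu)
    have h2 := (det_comp' (Ring.inverse T) T).symm.trans (h1.trans det_one')
    rw [not_not.1 hT, mul_zero] at h2
    exact zero_ne_one h2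

/-- The linear maps expanding lengths by a factor between `1` and `2`. -/
def moderate (k n : ℕ) : Set (Hom k n) := {X | ∀ y, ‖y‖ ≤ ‖X y‖ ∧ ‖X y‖ ≤ 2 * ‖y‖}

lemma isClosed_moderate : IsClosed (moderate k n) := by
  have h : moderate k n = ⋂ y, {X | ‖y‖ ≤ ‖X y‖ ∧ ‖X y‖ ≤ 2 * ‖y‖} := by
    ext X; simp [moderate]
  rw [h]
  refine isClosed_iInter fun y => ?_
  have hc : Continuous fun X : Hom k n => ‖X y‖ := (continuous_id.clm_apply continuous_const).norm
  exact (isClosed_le continuous_const hc).inter (isClosed_le hc continuous_const)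

lemma injective_of_moderate {X : Hom k n} (hX : X ∈ moderate k n) : Function.Injective X := by
  refine (injective_iff_map_eq_zero X).2 fun y hy => ?_
  have := (hX y).1
  rw [hy, norm_zero] at this
  exact norm_le_zero_iff.1 this

lemma isCompact_moderate : IsCompact (moderate k n) := by
  refine (isCompact_closedBall (0 : Hom k n) 2).of_isClosed_subset isClosed_moderate
    fun X hX => ?_
  rw [mem_closedBall_zero_iff]
  exact X.opNorm_le_bound (by norm_num) fun y => (hX y).2

/-- The total weight, for the invariant measure, of the `T` with `T⁻¹` moderate. -/
def moderateMass (k : ℕ) : ℝ≥0∞ :=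
  ∫⁻ T : Hom k k, (moderate k k).indicator 1 (Ring.inverse T) ∂(glHaar k)

lemma measurable_indicator_moderate :
    Measurable ((moderate k n).indicator (1 : Hom k n → ℝ≥0∞)) :=
  measurable_one.indicator isClosed_moderate.measurableSet

/-- Maps within `1/2` of `(3/2) • 1`, the midpoint of the allowed range `[1, 2]`, are moderate.
Their inverses contain a neighbourhood of `(2/3) • 1`, where the density does not vanish. -/
lemma moderateMass_ne_zero : moderateMass k ≠ 0 := by
  intro h0
  rw [moderateMass, lintegral_glHaar (f := fun T => (moderate k k).indicator 1 (Ring.inverse T))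
    (measurable_indicator_moderate.comp measurable_inverse)] at h0
  replace h0 := (lintegral_eq_zero_iff (measurable_glHaar_density.mul
    (measurable_indicator_moderate.comp measurable_inverse))).1 h0
  set V : Set (Hom k k) := {T | T.det ≠ 0} ∩
    Ring.inverse ⁻¹' Metric.ball ((3 / 2 : ℝ) • (1 : Hom k k)) (1 / 2) with hV
  have hVo : IsOpen V := continuousOn_inverse.isOpen_inter_preimage
    (isOpen_ne_fun continuous_det continuous_const) Metric.isOpen_ball
  have hdet : ((2 / 3 : ℝ) • (1 : Hom k k)).det ≠ 0 := by
    rw [det_ne_zero_iff]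
    exact smul_right_injective (Space k) (show (2 / 3 : ℝ) ≠ 0 by norm_num)
  have hinv : Ring.inverse ((2 / 3 : ℝ) • (1 : Hom k k)) = (3 / 2 : ℝ) • (1 : Hom k k) := by
    have h1 := Ring.mul_inverse_cancel _ (isUnit_of_det_ne_zero hdet)
    have h2 : ((3 / 2 : ℝ) • (1 : Hom k k)) * ((2 / 3 : ℝ) • (1 : Hom k k)) = 1 := by
      refine ContinuousLinearMap.ext fun y => ?_
      change (3 / 2 : ℝ) • (2 / 3 : ℝ) • y = y
      rw [smul_smul]
      norm_num
    exact (left_inv_eq_right_inv h2 h1).symm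
  have hVn : V.Nonempty := ⟨(2 / 3 : ℝ) • (1 : Hom k k), hdet, by
    rw [mem_preimage, hinv]; exact Metric.mem_ball_self (by norm_num)⟩
  have hsub : V ⊆ {T | ¬ ({T : Hom k k | T.det ≠ 0}.indicator
      (fun T => (ENNReal.ofReal (|T.det| ^ k))⁻¹) T *
      (moderate k k).indicator (1 : Hom k k → ℝ≥0∞) (Ring.inverse T) = 0)} := by
    rintro T ⟨hT, hb⟩
    have hm : Ring.inverse T ∈ moderate k k := by
      intro y
      rw [mem_preimage, mem_ball_iff_norm] at hb
      have h1 := (Ring.inverse T - (3 / 2 : ℝ) • (1 : Hom k k)).le_of_opNorm_le hb.le y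
      have h2 : (Ring.inverse T - (3 / 2 : ℝ) • (1 : Hom k k)) y =
        Ring.inverse T y - (3 / 2 : ℝ) • y := by simp
      rw [h2] at h1
      have h3 : ‖(3 / 2 : ℝ) • y‖ = 3 / 2 * ‖y‖ := by rw [norm_smul]; norm_num
      have h4 := norm_sub_norm_le (Ring.inverse T y) ((3 / 2 : ℝ) • y)
      have h5 := norm_sub_norm_le ((3 / 2 : ℝ) • y) (Ring.inverse T y)
      rw [norm_sub_rev] at h5
      constructor <;> linarith
    rw [Set.mem_ofPred_eq, Set.indicator_of_mem hT, Set.indicator_of_mem hm, Pi.one_apply, mul_one]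
    exact ENNReal.inv_ne_zero.2 ENNReal.ofReal_ne_top
  have hV0 : volume V = 0 := measure_mono_null hsub (ae_iff.1 h0)
  exact (hVo.measure_pos volume hVn).ne' hV0

lemma moderateMass_ne_top : moderateMass k ≠ ∞ := by
  -- the inverses of moderate maps form a compact set on which the determinant does not vanish
  have hK : IsCompact (Ring.inverse '' moderate k k) :=
    isCompact_moderate.image_of_continuousOn (continuousOn_inverse.mono
      fun T hT => (det_ne_zero_iff T).2 (injective_of_moderate hT))
  have hdet : ∀ T ∈ (Ring.inverse '' moderate k k : Set (Hom k k)), T.det ≠ 0 := by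
    rintro _ ⟨T, hT, rfl⟩
    exact left_ne_zero_of_mul_eq_one
      (det_inverse_mul ((det_ne_zero_iff T).2 (injective_of_moderate hT)))
  have hcont : ContinuousOn (fun T : Hom k k => (|T.det| ^ k)⁻¹) (Ring.inverse '' moderate k k) :=
    ((continuous_det.abs.pow k).continuousOn).inv₀ fun T hT => by
      exact pow_ne_zero _ (abs_ne_zero.2 (hdet T hT))
  obtain ⟨C, hC⟩ := hK.exists_bound_of_continuousOn hcont
  rw [moderateMass, lintegral_glHaar (f := fun T => (moderate k k).indicator 1 (Ring.inverse T))
    (measurable_indicator_moderate.comp measurable_inverse)]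
  refine ne_top_of_le_ne_top (b := ∫⁻ T : Hom k k,
    (Ring.inverse '' moderate k k).indicator (fun _ => ENNReal.ofReal C) T) ?_ ?_
  · rw [lintegral_indicator hK.measurableSet, lintegral_const, Measure.restrict_apply_univ]
    exact ENNReal.mul_ne_top ENNReal.ofReal_ne_top hK.measure_lt_top.ne
  · refine lintegral_mono fun T => ?_
    by_cases hT : T.det ≠ 0
    · by_cases hm : Ring.inverse T ∈ moderate k k
      · have hmem : T ∈ (Ring.inverse '' moderate k k : Set (Hom k k)) :=
          ⟨_, hm, Ring.inverse_inverse (isUnit_of_det_ne_zero hT)⟩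
        have hC' := (le_abs_self _).trans (hC T hmem)
        rw [Set.indicator_of_mem hm, Set.indicator_of_mem hmem,
          Set.indicator_of_mem (show T ∈ {T : Hom k k | T.det ≠ 0} from hT), Pi.one_apply, mul_one,
          ← ENNReal.ofReal_inv_of_pos (by positivity)]
        exact ENNReal.ofReal_le_ofReal hC'
      · rw [Set.indicator_of_notMem hm, mul_zero]
        exact zero_le
    · rw [Set.indicator_of_notMem (show T ∉ {T : Hom k k | T.det ≠ 0} from hT), zero_mul]
      exact zero_le

lemma isometry_comp_mem_moderate (Q : Space k →ₗᵢ[ℝ] Space n) (T : Hom k k) :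
    Q.toContinuousLinearMap.comp T ∈ moderate k n ↔ T ∈ moderate k k := by
  simp [moderate]

/-- With `X = Q S`, the isometry `Q` does not affect moderateness and right invariance under `T ↦ T
S` absorbs `S`. Every orbit thus carries the same mass of the cutoff, which can serve to normalise
integrals over orbits. -/
lemma lintegral_moderate (h : k ≤ n) {X : Hom k n} (hX : Function.Injective X) :
    ∫⁻ T : Hom k k, (moderate k n).indicator 1 (X.comp (Ring.inverse T)) ∂(glHaar k) =
      moderateMass k := by
  obtain ⟨Q, S, hS, rfl, -⟩ := Grassmannian.exists_polar h hX
  have hm : Measurable fun T : Hom k k => (moderate k k).indicator (1 : Hom k k → ℝ≥0∞)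
      (S.comp (Ring.inverse T)) :=
    measurable_indicator_moderate.comp
      ((continuous_const.clm_comp continuous_id).measurable.comp measurable_inverse)
  have h1 : ∀ T : Hom k k, (moderate k n).indicator (1 : Hom k n → ℝ≥0∞)
      ((Q.toContinuousLinearMap.comp S).comp (Ring.inverse T)) =
      (moderate k k).indicator (1 : Hom k k → ℝ≥0∞) (S.comp (Ring.inverse T)) := by
    intro T
    have := isometry_comp_mem_moderate Q (S.comp (Ring.inverse T))
    rw [ContinuousLinearMap.comp_assoc]
    by_cases hT : S.comp (Ring.inverse T) ∈ moderate k k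
    · rw [Set.indicator_of_mem hT, Set.indicator_of_mem (this.2 hT)]; rfl
    · rw [Set.indicator_of_notMem hT, Set.indicator_of_notMem (fun h => hT (this.1 h))]
  simp_rw [h1]
  rw [← lintegral_glHaar_comp_right S hS hm, moderateMass]
  refine lintegral_glHaar_congr fun T hT => ?_
  congr 1
  have hU := isUnit_of_det_ne_zero hT
  have hUS := isUnit_of_det_ne_zero hS
  change S * Ring.inverse (T * S) = _
  obtain ⟨t, rfl⟩ := hU
  obtain ⟨s, rfl⟩ := hUS
  rw [← Units.val_mul, Ring.inverse_unit, Ring.inverse_unit, ← Units.val_mul, mul_inv_rev,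
    mul_inv_cancel_left]

/-- The two sides are the two ways to integrate `Ψ X * w X * v (X T⁻¹)` over `(X, T)`. -/
lemma moderateMass_mul_lintegral (h : k ≤ n) {Ψ w : Hom k n → ℝ≥0∞} (hΨ : Measurable Ψ)
    (hw : Measurable w) (hΨ0 : ∀ X : Hom k n, ¬ Function.Injective X → Ψ X = 0)
    (hΨT : ∀ (X : Hom k n) (T : Hom k k), T.det ≠ 0 → Ψ (X.comp T) = Ψ X) :
    moderateMass k * ∫⁻ X : Hom k n, Ψ X * w X = ∫⁻ X : Hom k n, Ψ X * (moderate k n).indicator 1 X *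
      ∫⁻ T : Hom k k, w (X.comp T) * ENNReal.ofReal (|T.det| ^ n) ∂(glHaar k) := by
  have hcomp : Measurable fun q : Hom k n × Hom k k => q.1.comp q.2 :=
    (continuous_fst.clm_comp continuous_snd).measurable
  have hv := measurable_indicator_moderate (k := k) (n := n)
  have hcinv : Measurable fun q : Hom k n × Hom k k => q.1.comp (Ring.inverse q.2) :=
    hcomp.comp (measurable_fst.prodMk (measurable_inverse.comp measurable_snd))
  calc moderateMass k * ∫⁻ X : Hom k n, Ψ X * w X
      = ∫⁻ X : Hom k n, ∫⁻ T : Hom k k, Ψ X * w X *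
          (moderate k n).indicator 1 (X.comp (Ring.inverse T)) ∂(glHaar k) := by
        rw [← lintegral_const_mul (f := fun X => Ψ X * w X) _ (hΨ.mul hw)]
        refine lintegral_congr fun X => ?_
        rw [lintegral_const_mul
          (f := fun T : Hom k k => (moderate k n).indicator 1 (X.comp (Ring.inverse T))) _
          (hv.comp (hcinv.comp (measurable_const.prodMk measurable_id)))]
        by_cases hX : Function.Injective X
        · rw [lintegral_moderate h hX, mul_comm]
        · rw [hΨ0 X hX, zero_mul, zero_mul, mul_zero]
    _ = ∫⁻ T : Hom k k, (∫⁻ X : Hom k n, Ψ X * w X *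
          (moderate k n).indicator 1 (X.comp (Ring.inverse T))) ∂(glHaar k) :=
        lintegral_lintegral_swap (((hΨ.mul hw).comp measurable_fst).mul
          (hv.comp hcinv)).aemeasurable
    _ = ∫⁻ T : Hom k k, (∫⁻ X : Hom k n, Ψ X * (moderate k n).indicator 1 X *
          (w (X.comp T) * ENNReal.ofReal (|T.det| ^ n))) ∂(glHaar k) := by
        -- For fixed invertible `T`, substitute `X T` for `X`: Lebesgue measure contributes `|det T|
        -- ^ n`, `Ψ` is unchanged, and the cutoff becomes a function of `X` alone.
        refine lintegral_glHaar_congr fun T hT => ?_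
        have hm : Measurable fun X : Hom k n => Ψ X * w X *
            (moderate k n).indicator (1 : Hom k n → ℝ≥0∞) (X.comp (Ring.inverse T)) :=
          (hΨ.mul hw).mul (hv.comp (hcinv.comp (measurable_id.prodMk measurable_const)))
        have h1 := lintegral_comp_right T hT hm
        have hp : 0 < |T.det| ^ n := by positivity
        have hp0 : ENNReal.ofReal (|T.det| ^ n) ≠ 0 := (ENNReal.ofReal_pos.2 hp).ne'
        have h2 : ∀ X : Hom k n, (X.comp T).comp (Ring.inverse T) = X := fun X => by
          rw [ContinuousLinearMap.comp_assoc]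
          exact (congrArg X.comp (Ring.mul_inverse_cancel T (isUnit_of_det_ne_zero hT))).trans
            X.comp_id
        simp only [h2, hΨT _ T hT] at h1
        have h3 : ∫⁻ X : Hom k n, Ψ X * w X *
            (moderate k n).indicator (1 : Hom k n → ℝ≥0∞) (X.comp (Ring.inverse T)) =
            ENNReal.ofReal (|T.det| ^ n) *
            ∫⁻ X : Hom k n, Ψ X * w (X.comp T) * (moderate k n).indicator 1 X := by
          rw [h1, ← mul_assoc, ENNReal.mul_inv_cancel hp0 ENNReal.ofReal_ne_top, one_mul]
        rw [h3, ← lintegral_const_mul' _ _ ENNReal.ofReal_ne_top]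
        exact lintegral_congr fun X => by ring
    _ = ∫⁻ X : Hom k n, ∫⁻ T : Hom k k, Ψ X * (moderate k n).indicator 1 X *
          (w (X.comp T) * ENNReal.ofReal (|T.det| ^ n)) ∂(glHaar k) :=
        (lintegral_lintegral_swap (((hΨ.mul hv).comp measurable_fst).mul
          ((hw.comp hcomp).mul ((measurable_det_pow k n).comp measurable_snd))).aemeasurable).symm
    _ = _ := by
        refine lintegral_congr fun X => ?_
        exact lintegral_const_mul _ ((hw.comp (hcomp.comp (measurable_const.prodMk measurable_id))).mul
          (measurable_det_pow k n))

/-- The indicator function of the unit ball of `Hom k n`. -/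
def ballInd (X : Hom k n) : ℝ≥0∞ := (Metric.closedBall 0 1).indicator 1 X

lemma measurable_ballInd : Measurable (ballInd : Hom k n → ℝ≥0∞) :=
  measurable_one.indicator Metric.isClosed_closedBall.measurableSet

lemma ballInd_isometry_comp {m : ℕ} (Q : Space m →ₗᵢ[ℝ] Space n) (X : Hom k m) :
    ballInd (Q.toContinuousLinearMap.comp X) = ballInd X := by
  have h : Q.toContinuousLinearMap.comp X ∈ Metric.closedBall (0 : Hom k n) 1 ↔
      X ∈ Metric.closedBall (0 : Hom k m) 1 := by
    rw [mem_closedBall_zero_iff, mem_closedBall_zero_iff, Q.norm_toContinuousLinearMap_comp]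
  by_cases hX : X ∈ Metric.closedBall (0 : Hom k m) 1
  · rw [ballInd, ballInd, Set.indicator_of_mem hX, Set.indicator_of_mem (h.2 hX)]
    rfl
  · rw [ballInd, ballInd, Set.indicator_of_notMem hX,
      Set.indicator_of_notMem fun h1 => hX (h.1 h1)]

/-- Writing `Y = Q S`, invariance under `T ↦ S T` extracts `|det S| ^ (-n)`, and `|det S|` is
`normDet Y`. The remaining integral is the same for all `Y`. -/
lemma lintegral_ballInd_comp (h : k ≤ n) {Y : Hom k n} (hY : Function.Injective Y) :
    ∫⁻ T : Hom k k, ballInd (Y.comp T) * ENNReal.ofReal (|T.det| ^ n) ∂(glHaar k) =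
      (ENNReal.ofReal (Y.toLinearMap.normDet ^ n))⁻¹ *
      ∫⁻ T : Hom k k, ballInd T * ENNReal.ofReal (|T.det| ^ n) ∂(glHaar k) := by
  obtain ⟨Q, S, hS, rfl, -⟩ := Grassmannian.exists_polar h hY
  have hdet : (Q.toContinuousLinearMap.comp S).toLinearMap.normDet = |S.det| := by
    have h1 := LinearMap.normDet_comp_of_finrank_eq S.toLinearMap Q.toLinearMap rfl
    rw [Q.normDet_eq_one, one_mul, LinearMap.normDet_eq_abs_det] at h1
    exact h1
  have hm : Measurable fun T : Hom k k => ballInd T * ENNReal.ofReal (|T.det| ^ n) :=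
    measurable_ballInd.mul (measurable_det_pow k n)
  have hp0 : ENNReal.ofReal (|S.det| ^ n) ≠ 0 := (ENNReal.ofReal_pos.2 (by positivity)).ne'
  have h2 : ∀ T : Hom k k, ballInd (S.comp T) * ENNReal.ofReal (|(S.comp T).det| ^ n) =
      ENNReal.ofReal (|S.det| ^ n) * (ballInd (S.comp T) * ENNReal.ofReal (|T.det| ^ n)) := by
    intro T
    rw [det_comp', abs_mul, mul_pow, ENNReal.ofReal_mul (by positivity)]
    ring
  simp_rw [ContinuousLinearMap.comp_assoc, ballInd_isometry_comp]
  rw [hdet, ← lintegral_glHaar_comp_left S hS hm]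
  simp_rw [h2]
  rw [lintegral_const_mul' _ _ ENNReal.ofReal_ne_top, ← mul_assoc,
    ENNReal.inv_mul_cancel hp0 ENNReal.ofReal_ne_top, one_mul]

/-! ### Change of variables on the linear Grassmannian. -/

namespace Grassmannian

variable (h : k ≤ n)

/-- The law of the span of a random linear map from the unit ball, before normalisation. -/
def spanLaw : Measure (Grassmannian n k) :=
  (volume.restrict ({X : Hom k n | Function.Injective X} ∩ Metric.closedBall 0 1)).map (span h)

lemma measurableSet_injective : MeasurableSet {X : Hom k n | Function.Injective X} :=
  isOpen_injective.measurableSet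

lemma spanLaw_univ : spanLaw h univ =
    volume ({X : Hom k n | Function.Injective X} ∩ Metric.closedBall 0 1) := by
  rw [spanLaw, Measure.map_apply (measurable_span h) MeasurableSet.univ, preimage_univ,
    Measure.restrict_apply_univ]

lemma spanLaw_univ_ne_top : spanLaw h univ ≠ ∞ := by
  rw [spanLaw_univ]
  exact ((measure_mono inter_subset_right).trans_lt measure_closedBall_lt_top).ne

instance : IsFiniteMeasure (spanLaw h) := ⟨(spanLaw_univ_ne_top h).lt_top⟩

lemma spanLaw_univ_ne_zero : spanLaw h univ ≠ 0 := by
  rw [spanLaw_univ]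
  obtain ⟨Q, -⟩ := exists_frame (coord h)
  have hne : ({X : Hom k n | Function.Injective X} ∩ Metric.ball 0 1).Nonempty := by
    refine ⟨(1 / 2 : ℝ) • Q.toContinuousLinearMap, ?_, ?_⟩
    · exact (smul_right_injective (Space n) (show (1 / 2 : ℝ) ≠ 0 by norm_num)).comp Q.injective
    · rw [mem_ball_zero_iff, norm_smul]
      have := Q.norm_toContinuousLinearMap_le
      norm_num
      linarith
  refine (lt_of_lt_of_le ((isOpen_injective.inter Metric.isOpen_ball).measure_pos volume hne)
    (measure_mono (inter_subset_inter_right _ Metric.ball_subset_closedBall))).ne'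

lemma lintegral_spanLaw {Φ : Grassmannian n k → ℝ≥0∞} (hΦ : Measurable Φ) :
    ∫⁻ E, Φ E ∂(spanLaw h) = ∫⁻ X : Hom k n, {X : Hom k n | Function.Injective X}.indicator
      (fun X => Φ (span h X)) X * ballInd X := by
  rw [spanLaw, lintegral_map hΦ (measurable_span h),
    ← lintegral_indicator (measurableSet_injective.inter
      Metric.isClosed_closedBall.measurableSet)]
  refine lintegral_congr fun X => ?_
  by_cases h1 : X ∈ {X : Hom k n | Function.Injective X} <;>
    by_cases h2 : X ∈ Metric.closedBall (0 : Hom k n) 1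
  · rw [Set.indicator_of_mem (show X ∈ _ ∩ _ from ⟨h1, h2⟩), Set.indicator_of_mem h1, ballInd, Set.indicator_of_mem h2,
      Pi.one_apply, mul_one]
  · rw [Set.indicator_of_notMem fun h3 => h2 h3.2, ballInd, Set.indicator_of_notMem h2, mul_zero]
  all_goals rw [Set.indicator_of_notMem fun h3 => h1 h3.1, Set.indicator_of_notMem h1, zero_mul]

/-- Postcomposition with an orthogonal map preserves Lebesgue measure on `Hom k n`, the operator
norm and injectivity. -/
lemma map_rotate_spanLaw (U : OrthGroup n) : (spanLaw h).map (rotate U) = spanLaw h := by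
  set M : Hom n n := Matrix.toEuclideanCLM (n := Fin n) (𝕜 := ℝ) U.1 with hM
  have hdet : |M.det| = 1 := by
    have := (orthAct U).toLinearIsometry.normDet_eq_one
    rw [LinearMap.normDet_eq_abs_det] at this
    exact this
  refine Measure.ext_of_lintegral _ fun Φ hΦ => ?_
  rw [lintegral_map hΦ (measurable_rotate U), lintegral_spanLaw h (Φ := fun E => Φ (rotate U E))
      (hΦ.comp (measurable_rotate U)),
    lintegral_spanLaw h hΦ]
  have hm : Measurable fun X : Hom k n => {X : Hom k n | Function.Injective X}.indicator
      (fun X => Φ (span h X)) X * ballInd X :=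
    ((hΦ.comp (measurable_span h)).indicator measurableSet_injective).mul measurable_ballInd
  have h1 := lintegral_comp_left M (by rw [← abs_ne_zero, hdet]; exact one_ne_zero) hm
  rw [hdet, one_pow, ENNReal.ofReal_one, inv_one, one_mul] at h1
  rw [← h1]
  refine lintegral_congr fun X => ?_
  congr 1
  · by_cases hX : X ∈ {X : Hom k n | Function.Injective X}
    · have hX' : M.comp X ∈ {X : Hom k n | Function.Injective X} := (orthAct U).injective.comp hX
      rw [Set.indicator_of_mem hX, Set.indicator_of_mem hX', rotate_span h hX]
    · have hX' : M.comp X ∉ {X : Hom k n | Function.Injective X} := fun h2 =>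
        hX (Function.Injective.of_comp (f := M) h2)
      rw [Set.indicator_of_notMem hX, Set.indicator_of_notMem hX']
  · exact (ballInd_isometry_comp (orthAct U).toLinearIsometry X).symm

/-- Under a linear map of determinant `±1`, the measure `μ_{n,k}` changes by the density
`J_A(E)^n`. -/
lemma lintegral_map_haar (A : Space n ≃L[ℝ] Space n) (hA : |(A : Hom n n).det| = 1)
    {Φ : Grassmannian n k → ℝ≥0∞} (hΦ : Measurable Φ) :
    ∫⁻ E, Φ (map A E) * (ENNReal.ofReal (jac A E ^ n))⁻¹ ∂(haar h) = ∫⁻ E, Φ E ∂(haar h) := by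
  have hmap : Measurable fun E : Grassmannian n k => Φ (map A E) :=
    hΦ.comp (continuous_map h A).measurable
  have hj : Measurable fun E : Grassmannian n k => (ENNReal.ofReal (jac A E ^ n))⁻¹ :=
    ((continuous_jac h A).pow n).measurable.ennreal_ofReal.inv
  set O : Set (Hom k n) := {X : Hom k n | Function.Injective X} with hO
  have hAc : Measurable fun X : Hom k n => (A : Hom n n).comp X :=
    (continuous_const.clm_comp continuous_id).measurable
  have hOT : ∀ (X : Hom k n) (T : Hom k k), T.det ≠ 0 → (X.comp T ∈ O ↔ X ∈ O) := by
    intro X T hT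
    have hi := (det_ne_zero_iff T).1 hT
    have hs := (LinearMap.injective_iff_surjective (f := T.toLinearMap)).1 hi
    exact ⟨fun h1 => Function.Injective.of_comp_right (f := X) h1 hs, fun h1 => h1.comp hi⟩
  have hinv : ∀ (F : Grassmannian n k → ℝ≥0∞) (X : Hom k n) (T : Hom k k), T.det ≠ 0 →
      O.indicator (fun X => F (span h X)) (X.comp T) = O.indicator (fun X => F (span h X)) X := by
    intro F X T hT
    by_cases hX : X ∈ O
    · rw [Set.indicator_of_mem hX, Set.indicator_of_mem ((hOT X T hT).2 hX),
        span_comp_right h hX hT]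
    · rw [Set.indicator_of_notMem hX, Set.indicator_of_notMem fun h1 => hX ((hOT X T hT).1 h1)]
  have hmeas : ∀ {F : Grassmannian n k → ℝ≥0∞}, Measurable F →
      Measurable (O.indicator fun X => F (span h X)) := fun hF =>
    (hF.comp (measurable_span h)).indicator measurableSet_injective
  -- Compare the body `{X | ‖A X‖ ≤ 1}` with the unit ball. After disintegration along orbits, their
  -- weights at `X` differ by the factor `J ^ (-n)`; the positive finite constant `moderateMass k`
  -- is then cancelled.
  have key : ∫⁻ X : Hom k n, O.indicator (fun X => Φ (map A (span h X))) X *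
        ballInd ((A : Hom n n).comp X) =
      ∫⁻ X : Hom k n, O.indicator (fun X => Φ (map A (span h X)) *
        (ENNReal.ofReal (jac A (span h X) ^ n))⁻¹) X * ballInd X := by
    refine (ENNReal.mul_right_inj moderateMass_ne_zero moderateMass_ne_top).1
      ((moderateMass_mul_lintegral h (hmeas hmap) (measurable_ballInd.comp hAc)
        (fun X hX => Set.indicator_of_notMem hX _) (hinv fun E => Φ (map A E))).trans
      (Eq.trans ?_ (moderateMass_mul_lintegral h (hmeas (hmap.mul hj)) measurable_ballInd
        (fun X hX => Set.indicator_of_notMem hX _)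
        (hinv fun E => Φ (map A E) * (ENNReal.ofReal (jac A E ^ n))⁻¹)).symm))
    refine lintegral_congr fun X => ?_
    by_cases hX : X ∈ O
    · have hAX : Function.Injective ((A : Hom n n).comp X) := A.injective.comp hX
      have h1 := lintegral_ballInd_comp h hAX
      have hjp : 0 < jac A (span h X) ^ n := pow_pos (jac_pos A _) n
      rw [normDet_comp_left h hX, mul_pow, ENNReal.ofReal_mul hjp.le, ENNReal.mul_inv
        (Or.inl (ENNReal.ofReal_pos.2 hjp).ne') (Or.inl ENNReal.ofReal_ne_top), mul_assoc,
        ← lintegral_ballInd_comp h hX] at h1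
      rw [Set.indicator_of_mem hX, Set.indicator_of_mem hX]
      have h2 : ∫⁻ T : Hom k k, (ballInd ∘ fun X : Hom k n => (A : Hom n n).comp X) (X.comp T) *
          ENNReal.ofReal (|T.det| ^ n) ∂(glHaar k) = _ := h1
      rw [h2]
      simp only [Pi.mul_apply]
      ring
    · rw [Set.indicator_of_notMem hX, Set.indicator_of_notMem hX]
      simp
  -- Here `|det A| = 1` enters: `X ↦ A X` preserves Lebesgue measure on `Hom k n`.
  have hleft : ∫⁻ X : Hom k n, O.indicator (fun X => Φ (map A (span h X))) X *
        ballInd ((A : Hom n n).comp X) = ∫⁻ E, Φ E ∂(spanLaw h) := by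
    rw [lintegral_spanLaw h hΦ]
    have h1 := lintegral_comp_left (A : Hom n n) (by rw [← abs_ne_zero, hA]; exact one_ne_zero)
      ((hmeas hΦ).mul (measurable_ballInd (k := k) (n := n)))
    rw [hA, one_pow, ENNReal.ofReal_one, inv_one, one_mul] at h1
    refine Eq.trans (lintegral_congr fun X => ?_) h1
    simp only [Pi.mul_apply]
    congr 1
    by_cases hX : X ∈ O
    · have hX' : (A : Hom n n).comp X ∈ O := A.injective.comp hX
      rw [Set.indicator_of_mem hX, Set.indicator_of_mem hX', span_comp_left h hX]
    · have hX' : (A : Hom n n).comp X ∉ O := fun h2 =>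
        hX (Function.Injective.of_comp (f := A) h2)
      rw [Set.indicator_of_notMem hX, Set.indicator_of_notMem hX']
  have hright := lintegral_spanLaw h (hmap.mul hj)
  have := (hleft.symm.trans key).trans hright.symm
  rw [lintegral_eq_of_invariant h _ (map_rotate_spanLaw h) hΦ,
    lintegral_eq_of_invariant h _ (map_rotate_spanLaw h) (hmap.mul hj)] at this
  exact ((ENNReal.mul_right_inj (spanLaw_univ_ne_zero h) (spanLaw_univ_ne_top h)).1 this).symm

end Grassmannian

/-! ### Affine transformations and their linear parts. -/

/-- The linear part of an affine transformation. -/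
def linPart (g : Space n ≃ᵃ[ℝ] Space n) : Space n ≃L[ℝ] Space n :=
  g.linear.toContinuousLinearEquiv

lemma apply_add (g : Space n ≃ᵃ[ℝ] Space n) (v z : Space n) :
    g (v + z) = linPart g v + g z := g.map_vadd z v

lemma symm_apply_add (g : Space n ≃ᵃ[ℝ] Space n) (v z : Space n) :
    g.symm (v + z) = (linPart g).symm v + g.symm z := g.symm.map_vadd z v

lemma continuous_affineEquiv (g : Space n ≃ᵃ[ℝ] Space n) : Continuous g := by
  have h : ⇑g = fun v => linPart g v + g 0 := funext fun v => by rw [← apply_add, add_zero]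
  rw [h]
  exact (linPart g).continuous.add continuous_const

/-- Removing the translation leaves a volume-preserving linear map; the general scaling formula
evaluated on the unit ball then forces the determinant. -/
lemma abs_det_linPart {g : Space n ≃ᵃ[ℝ] Space n}
    (hg : MeasurePreserving g volume volume) : |(linPart g : Hom n n).det| = 1 := by
  have h1 : MeasurePreserving (linPart g) (volume : Measure (Space n)) volume := by
    have h2 := (measurePreserving_add_right (volume : Measure (Space n)) (-g 0)).comp hg
    have h3 : (fun x => x + -g 0) ∘ g = linPart g := by
      ext1 v
      have := apply_add g v 0
      rw [add_zero] at this
      simp [this]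
    rwa [h3] at h2
  have hdet : LinearMap.det (linPart g).toLinearEquiv.toLinearMap ≠ 0 :=
    (LinearEquiv.isUnit_det' (linPart g).toLinearEquiv).ne_zero
  have h2 := Measure.map_linearMap_addHaar_eq_smul_addHaar (volume : Measure (Space n)) hdet
  have h3 : (volume : Measure (Space n)).map (linPart g).toLinearEquiv.toLinearMap = volume :=
    h1.map_eq
  rw [h3] at h2
  have h4 := congrArg (fun μ => μ (Metric.closedBall (0 : Space n) 1)) h2
  have h5 : volume (Metric.closedBall (0 : Space n) 1) ≠ 0 :=
    (Metric.measure_closedBall_pos _ _ one_pos).ne'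
  have h6 : volume (Metric.closedBall (0 : Space n) 1) ≠ ∞ := measure_closedBall_lt_top.ne
  simp only [Measure.smul_apply, smul_eq_mul] at h4
  have h7 : ENNReal.ofReal |(LinearMap.det (linPart g).toLinearEquiv.toLinearMap)⁻¹| = 1 := by
    refine (ENNReal.mul_left_inj h5 h6).1 ?_
    rw [one_mul]; exact h4.symm
  rw [ENNReal.ofReal_eq_one, abs_inv, inv_eq_one] at h7
  exact h7

/-! ### Scaling of `k`-dimensional volume on subspaces. -/

section Hausdorff

open Measure

lemma hausdorff_image_linear (A : Space n ≃L[ℝ] Space n) (E : Grassmannian n k)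
    {s : Set (Space n)} (hs : s ⊆ E.1) :
    euclideanHausdorffMeasure k (A '' s) =
      ENNReal.ofReal (E.jac A) * euclideanHausdorffMeasure k s := by
  have h1 := (A.toLinearEquiv.toLinearMap.domRestrict E.1).euclideanHausdorffMeasure_image
    ((↑) ⁻¹' s)
  have hiso : Isometry ((↑) : E.1 → Space n) := isometry_subtype_coe
  have h2 := hiso.euclideanHausdorffMeasure_image (d := k) ((↑) ⁻¹' s)
  have h3 : ((↑) : E.1 → Space n) '' ((↑) ⁻¹' s) = s := by
    refine image_preimage_eq_of_subset fun x hx => ?_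
    exact ⟨⟨x, hs hx⟩, rfl⟩
  rw [h3] at h2
  rw [E.2] at h1
  rw [h2, Grassmannian.jac, ← h1]
  congr 1
  conv_lhs => rw [← h3, image_image]
  rfl

lemma hausdorff_image_affine (g : Space n ≃ᵃ[ℝ] Space n) (F : AffineGrassmannian n k)
    {s : Set (Space n)} (hs : s ⊆ F.1) :
    euclideanHausdorffMeasure k (g '' s) =
      ENNReal.ofReal (F.dir.jac (linPart g)) * euclideanHausdorffMeasure k s := by
  obtain ⟨z, hz⟩ := F.2.1
  have h1 := hausdorff_image_linear (linPart g) F.dir (s := (fun x => x - z) '' s) (by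
    rintro _ ⟨x, hx, rfl⟩
    exact AffineSubspace.vsub_mem_direction (hs hx) hz)
  have h2 : Isometry fun x : Space n => x - z := (IsometryEquiv.subRight z).isometry
  have h3 : Isometry fun x : Space n => x + g z := (IsometryEquiv.addRight (g z)).isometry
  rw [h2.euclideanHausdorffMeasure_image] at h1
  rw [← h1, ← h3.euclideanHausdorffMeasure_image (linPart g '' _), image_image, image_image]
  congr 1
  refine image_congr fun x _ => ?_
  rw [← apply_add g (x - z) z, sub_add_cancel]

end Hausdorff

/-! ### The affine action on the affine Grassmannian. -/

namespace AffineGrassmannian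

/-- The image of an affine subspace under an affine transformation. -/
def map (g : Space n ≃ᵃ[ℝ] Space n) (F : AffineGrassmannian n k) : AffineGrassmannian n k :=
  ⟨F.1.map g.toAffineMap, by
    rw [AffineSubspace.coe_map]
    exact F.2.1.image _, by
    rw [AffineSubspace.map_direction]
    exact (LinearEquiv.finrank_map_eq g.linear F.1.direction).trans F.2.2⟩

lemma coe_map (g : Space n ≃ᵃ[ℝ] Space n) (F : AffineGrassmannian n k) :
    ((map g F).1 : Set (Space n)) = g '' F.1 := AffineSubspace.coe_map _ _

lemma map_mk (g : Space n ≃ᵃ[ℝ] Space n) (E : Grassmannian n k) (z : Space n) :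
    map g (mk E z) = mk (E.map (linPart g)) (g z) :=
  Subtype.ext (AffineSubspace.map_mk' _ _ _)

lemma foot_mem (F : AffineGrassmannian n k) : F.foot ∈ F.1 := by
  have : Nonempty F.1 := F.2.1.to_subtype
  exact (EuclideanGeometry.orthogonalProjection F.1 (0 : Space n)).2

lemma mk_dir_foot (F : AffineGrassmannian n k) : mk F.dir F.foot = F :=
  Subtype.ext (AffineSubspace.mk'_eq F.foot_mem)

lemma map_symm_map (g : Space n ≃ᵃ[ℝ] Space n) (F : AffineGrassmannian n k) :
    map g.symm (map g F) = F := by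
  refine Subtype.ext (SetLike.coe_injective ?_)
  rw [coe_map, coe_map, image_image]
  simp

lemma continuous_dir : Continuous (dir : AffineGrassmannian n k → _) :=
  continuous_fst.comp
    (continuous_induced_dom (f := fun F : AffineGrassmannian n k => (F.dir, F.foot)))

lemma continuous_foot : Continuous (foot : AffineGrassmannian n k → _) :=
  continuous_snd.comp
    (continuous_induced_dom (f := fun F : AffineGrassmannian n k => (F.dir, F.foot)))

lemma measurable_map (h : k ≤ n) (g : Space n ≃ᵃ[ℝ] Space n) :
    Measurable (map g : AffineGrassmannian n k → _) := by
  have h1 : (map g : AffineGrassmannian n k → _) = (fun q => mk q.1 q.2) ∘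
      fun F : AffineGrassmannian n k => (F.dir.map (linPart g), g F.foot) := by
    ext1 F
    conv_lhs => rw [← mk_dir_foot F, map_mk]
    rfl
  rw [h1]
  exact measurable_mk.comp (((Grassmannian.continuous_map h (linPart g)).comp
    continuous_dir).prodMk ((continuous_affineEquiv g).comp continuous_foot)).measurable

/-- The action of an affine transformation on the affine Grassmannian. -/
def mapEquiv (h : k ≤ n) (g : Space n ≃ᵃ[ℝ] Space n) :
    AffineGrassmannian n k ≃ᵐ AffineGrassmannian n k where
  toFun := map g
  invFun := map g.symm
  left_inv := map_symm_map g
  right_inv := map_symm_map g.symm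
  measurable_toFun := measurable_map h g
  measurable_invFun := measurable_map h g.symm

lemma mk_add_left (E : Grassmannian n k) {e : Space n} (he : e ∈ E.1) (z : Space n) :
    mk E (e + z) = mk E z := by
  refine Subtype.ext (AffineSubspace.ext fun y => ?_)
  change y ∈ AffineSubspace.mk' _ _ ↔ y ∈ AffineSubspace.mk' _ _
  simp only [AffineSubspace.mem_mk', vsub_eq_sub]
  rw [show y - z = (y - (e + z)) + e by abel]
  exact (E.1.add_mem_iff_left he).symm

end AffineGrassmannian

/-! ### Transformation of the norms on planes. -/

section PlaneNorm

lemma lintegral_affineSubspace (F : AffineSubspace ℝ (Space n)) (φ : Space n → ℝ≥0∞) :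
    ∫⁻ x : F, φ x ∂(Measure.euclideanHausdorffMeasure k) =
      ∫⁻ x in F, φ x ∂(Measure.euclideanHausdorffMeasure k) := by
  have hiso : Isometry ((↑) : F → Space n) := isometry_subtype_coe
  have hcl : MeasurableSet (F : Set (Space n)) :=
    (AffineSubspace.closed_of_finiteDimensional F).measurableSet
  have h1 := hiso.map_euclideanHausdorffMeasure (d := k)
  have h2 : range ((↑) : F → Space n) = F := Subtype.range_coe
  rw [h2] at h1
  rw [← h1]
  exact (MeasurableEmbedding.lintegral_map (MeasurableEmbedding.subtype_coe hcl) φ).symm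

/-- `φ` is arbitrary because an almost everywhere measurable function on `ℝⁿ` may restrict to a
nonmeasurable one on a given plane. Pushing forward along the measurable equivalence `g` avoids the
issue. -/
lemma lintegral_map_affine (g : Space n ≃ᵃ[ℝ] Space n) (F : AffineGrassmannian n k)
    (φ : Space n → ℝ≥0∞) :
    ∫⁻ x : (F.map g).1, φ (g.symm x) ∂(Measure.euclideanHausdorffMeasure k) =
      ENNReal.ofReal (F.dir.jac (linPart g)) *
      ∫⁻ x : F.1, φ x ∂(Measure.euclideanHausdorffMeasure k) := by
  rw [lintegral_affineSubspace (F.map g).1 fun x => φ (g.symm x), lintegral_affineSubspace F.1 φ]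
  let e : Space n ≃ᵐ Space n :=
    { toEquiv := g.toEquiv
      measurable_toFun := (continuous_affineEquiv g).measurable
      measurable_invFun := (continuous_affineEquiv g.symm).measurable }
  have hF : MeasurableSet (F.1 : Set (Space n)) :=
    (AffineSubspace.closed_of_finiteDimensional F.1).measurableSet
  have h1 : (Measure.euclideanHausdorffMeasure k).restrict ((F.map g).1 : Set (Space n)) =
      ENNReal.ofReal (F.dir.jac (linPart g)) •
        ((Measure.euclideanHausdorffMeasure k).restrict (F.1 : Set (Space n))).map e := by
    ext B hB
    rw [Measure.restrict_apply hB, Measure.smul_apply, Measure.map_apply e.measurable hB,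
      Measure.restrict_apply (e.measurable hB), smul_eq_mul,
      ← hausdorff_image_affine g F inter_subset_right, AffineGrassmannian.coe_map]
    congr 1
    exact (image_preimage_inter (⇑g) _ _).symm
  rw [h1, lintegral_smul_measure, lintegral_map_equiv, smul_eq_mul]
  congr 1
  refine lintegral_congr fun x => ?_
  exact congrArg φ (g.symm_apply_apply x)

/-- A positive finite factor can be pulled out for every real exponent, even when `x` is `0` or `∞`;
this is what makes the conventions for negative powers harmless. -/
lemma ofReal_mul_rpow {a : ℝ} (ha : 0 < a) (x : ℝ≥0∞) (z : ℝ) :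
    (ENNReal.ofReal a * x) ^ z = ENNReal.ofReal (a ^ z) * x ^ z := by
  rw [ENNReal.mul_rpow_eq_ite, if_neg, ENNReal.ofReal_rpow_of_pos ha]
  rintro ⟨h | h, -⟩
  · exact (ENNReal.ofReal_pos.2 ha).ne' h.1
  · exact ENNReal.ofReal_ne_top h.1

lemma planeNorm_map {𝕜 : Type*} [RCLike 𝕜] (f : Space n → 𝕜) {p : ℝ}
    (g : Space n ≃ᵃ[ℝ] Space n) (F : AffineGrassmannian n k) :
    planeNorm (fun t => f (g.symm t)) p (F.map g) =
      ENNReal.ofReal (F.dir.jac (linPart g) ^ (1 / p)) * planeNorm f p F := by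
  have h := congrArg (· ^ (1 / p)) (lintegral_map_affine g F fun x => ‖f x‖ₑ ^ p)
  exact h.trans (ofReal_mul_rpow (Grassmannian.jac_pos _ _) _ _)

lemma prod_planeNorm_map {m : ℕ} {𝕜 : Type*} [RCLike 𝕜] (p α : Fin m → ℝ)
    (f : Fin m → Space n → 𝕜) (g : Space n ≃ᵃ[ℝ] Space n) (F : AffineGrassmannian n k)
    (hsum : ∑ i, α i / p i = (n : ℝ) + 1) :
    ∏ i, planeNorm (fun t => f i (g.symm t)) (p i) (F.map g) ^ α i =
      ENNReal.ofReal (F.dir.jac (linPart g) ^ (n + 1)) * ∏ i, planeNorm (f i) (p i) F ^ α i := by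
  set J := F.dir.jac (linPart g) with hJ
  have hJ0 : 0 < J := Grassmannian.jac_pos _ _
  have h1 : ∀ i, planeNorm (fun t => f i (g.symm t)) (p i) (F.map g) ^ α i =
      ENNReal.ofReal (J ^ (α i / p i)) * planeNorm (f i) (p i) F ^ α i := by
    intro i
    rw [planeNorm_map, ← hJ, ofReal_mul_rpow (Real.rpow_pos_of_pos hJ0 _),
      ← Real.rpow_mul hJ0.le, div_mul_eq_mul_div, one_mul]
  simp_rw [h1]
  rw [Finset.prod_mul_distrib, ← ENNReal.ofReal_prod_of_nonneg
    fun i _ => (Real.rpow_pos_of_pos hJ0 _).le, ← Real.rpow_sum_of_pos hJ0, hsum]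
  norm_cast

end PlaneNorm

/-! ### Change of variables between orthogonal complements. -/

section Fibre

open Measure AffineGrassmannian

lemma volume_subspace_eq (E : Grassmannian n k) (t : Set E.1) :
    volume t = euclideanHausdorffMeasure k (((↑) : E.1 → Space n) '' t) := by
  have hiso : Isometry ((↑) : E.1 → Space n) := isometry_subtype_coe
  rw [hiso.euclideanHausdorffMeasure_image, ← InnerProductSpace.euclideanHausdorffMeasure_eq_volume,
    E.2]

/-- Fubini's theorem along `E` and its orthogonal complement. -/
lemma volume_eq_lintegral_fibre (E : Submodule ℝ (Space n)) {S : Set (Space n)}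
    (hS : MeasurableSet S) :
    volume S = ∫⁻ x : Eᗮ, volume {e : E | (e : Space n) + x ∈ S} := by
  have hp := (E.measurePreserving_measurableEquivProd (0 : Space n)).symm.measure_preimage_equiv S
  rw [InnerProductSpace.euclideanHausdorffMeasure_eq_volume] at hp
  rw [← hp, volume_eq_prod, prod_apply_symm
    ((E.measurableEquivProd (0 : Space n)).symm.measurable hS)]
  refine lintegral_congr fun x => ?_
  congr 1
  ext e
  simp

/-- Cavalieri's principle for a set whose nonempty slices parallel to `E` all have the same volume,
though possibly different positions. -/
lemma volume_eq_mul_of_fibre (E : Submodule ℝ (Space n)) {S : Set (Space n)}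
    (hS : MeasurableSet S) {U : Set Eᗮ} (hU : MeasurableSet U) (c : ℝ≥0∞)
    (hin : ∀ x ∈ U, volume {e : E | (e : Space n) + x ∈ S} = c)
    (hout : ∀ x : Eᗮ, x ∉ U → ∀ e : E, (e : Space n) + x ∉ S) :
    volume S = c * volume U := by
  rw [volume_eq_lintegral_fibre E hS, ← lintegral_indicator_const hU]
  refine lintegral_congr fun x => ?_
  by_cases hx : x ∈ U
  · rw [hin x hx, Set.indicator_of_mem hx]
  · rw [Set.indicator_of_notMem hx]
    refine measure_mono_null (t := ∅) (fun e he => hout x hx e he) measure_empty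

/-- The induced map between the complements need not be the restriction of `g`. Instead, the volume
of one set is computed by slicing it along `E` after pulling back by `g`, and along the image of `E`
directly. -/
lemma volume_fibre_map (g : Space n ≃ᵃ[ℝ] Space n) (hg : MeasurePreserving g volume volume)
    (E : Grassmannian n k) {B : Set (AffineGrassmannian n k)} (hB : MeasurableSet B) :
    volume {x : E.1ᗮ | AffineGrassmannian.map g (mk E (x : Space n)) ∈ B} =
      ENNReal.ofReal (E.jac (linPart g)) *
        volume {y : (E.map (linPart g)).1ᗮ | mk (E.map (linPart g)) (y : Space n) ∈ B} := by
  set A := linPart g with hA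
  set E' := E.map A with hE'
  set c : ℝ≥0∞ := volume (Metric.closedBall (0 : E.1) 1) with hc
  have hc0 : c ≠ 0 := (Metric.measure_closedBall_pos _ _ one_pos).ne'
  have hct : c ≠ ∞ := measure_closedBall_lt_top.ne
  have hmk : ∀ D : Grassmannian n k, Measurable fun z : Space n => mk D z := fun D =>
    measurable_mk.comp (measurable_const.prodMk measurable_id)
  -- The condition on `g.symm z` bounds the slices to unit balls of `E`, so that they have positive
  -- finite volume `c`, which can be cancelled.
  set T : Set (Space n) := {z | ‖E.proj (g.symm z)‖ ≤ 1 ∧ mk E' z ∈ B} with hT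
  have hTm : MeasurableSet T :=
    (measurableSet_le (E.proj.continuous.comp (continuous_affineEquiv g.symm)).norm.measurable
      measurable_const).inter (hmk E' hB)
  have hadd : ∀ e ∈ E.1, ∀ z : Space n, mk E' (g (e + z)) = mk E' (g z) := by
    intro e he z
    rw [apply_add]
    exact mk_add_left E' ⟨e, he, rfl⟩ _
  have hproj : ∀ e ∈ E.1, E.proj e = e := fun e he => E.1.starProjection_eq_self_iff.2 he
  have hlhs : volume T = c * volume {x : E.1ᗮ | mk E' (g x) ∈ B} := by
    rw [← hg.measure_preimage hTm.nullMeasurableSet]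
    refine volume_eq_mul_of_fibre E.1 (hg.measurable hTm)
      (((hmk E').comp (hg.measurable.comp measurable_subtype_coe)) hB) c (fun x hx => ?_)
      fun x hx e he => hx ?_
    · congr 1
      ext e
      have h1 : E.proj (e + x) = e := by
        rw [_root_.map_add, hproj e e.2]
        exact add_eq_left.2 ((Submodule.starProjection_apply_eq_zero_iff E.1).2 x.2)
      change (‖E.proj (g.symm (g (e + x)))‖ ≤ 1 ∧ mk E' (g (e + x)) ∈ B) ↔ _
      rw [g.symm_apply_apply, h1, hadd e e.2, mem_closedBall_zero_iff]
      exact and_iff_left hx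
    · have h2 := he.2
      rw [hadd e e.2] at h2
      exact h2
  have hrhs : volume T = ENNReal.ofReal (E.jac A) * c *
      volume {y : E'.1ᗮ | mk E' (y : Space n) ∈ B} := by
    refine volume_eq_mul_of_fibre E'.1 hTm (((hmk E').comp measurable_subtype_coe) hB) _
      (fun y hy => ?_) fun y hy e he => hy ?_
    · set v : E.1 := ⟨E.proj (g.symm y), E.1.starProjection_apply_mem _⟩ with hv
      have h1 : ((↑) : E'.1 → Space n) '' {e : E'.1 | (e : Space n) + y ∈ T} =
          A '' (((↑) : E.1 → Space n) '' Metric.closedBall (-v) 1) := by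
        have hiff : ∀ e : E.1, (A e + y ∈ T ↔ e ∈ Metric.closedBall (-v) 1) := by
          intro e
          have h3 : E.proj (g.symm (A e + y)) = ((e + v : E.1) : Space n) := by
            rw [symm_apply_add, _root_.map_add, ← hA, A.symm_apply_apply, hproj e e.2]
            rfl
          have h4 : mk E' (A e + y) = mk E' y := mk_add_left E' ⟨e, e.2, rfl⟩ _
          change (‖E.proj (g.symm (A e + y))‖ ≤ 1 ∧ mk E' (A e + y) ∈ B) ↔ _
          rw [h3, h4, mem_closedBall_iff_norm, sub_neg_eq_add]
          exact and_iff_left hy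
        ext z
        constructor
        · rintro ⟨⟨_, e, he, rfl⟩, hz, rfl⟩
          exact ⟨e, ⟨⟨e, he⟩, (hiff ⟨e, he⟩).1 hz, rfl⟩, rfl⟩
        · rintro ⟨_, ⟨e, he, rfl⟩, rfl⟩
          exact ⟨⟨A e, e, e.2, rfl⟩, (hiff e).2 he, rfl⟩
      rw [volume_subspace_eq, h1, hausdorff_image_linear A E, ← volume_subspace_eq,
        addHaar_closedBall_center]
      rintro _ ⟨e, -, rfl⟩
      exact e.2
    · have h2 := he.2
      rw [mk_add_left E' e.2] at h2
      exact h2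
  rw [mul_comm (ENNReal.ofReal _), mul_assoc] at hrhs
  simp_rw [map_mk]
  exact (ENNReal.mul_right_inj hc0 hct).1 (hlhs.symm.trans hrhs)

end Fibre

/-! ### Change of variables on the affine Grassmannian. -/

namespace AffineGrassmannian

/-- The density of the image of `ν_{n,k}` under `g⁻¹`. -/
def jacDensity (g : Space n ≃ᵃ[ℝ] Space n) (F : AffineGrassmannian n k) : ℝ≥0∞ :=
  (ENNReal.ofReal (F.dir.jac (linPart g) ^ (n + 1)))⁻¹

lemma measurable_jacDensity (h : k ≤ n) (g : Space n ≃ᵃ[ℝ] Space n) :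
    Measurable (jacDensity g : AffineGrassmannian n k → _) :=
  (((Grassmannian.continuous_jac h (linPart g)).comp
    continuous_dir).pow (n + 1)).measurable.ennreal_ofReal.inv

/-- Of the `n + 1` inverse powers of `J`, one cancels the factor from `volume_fibre_map` and the
other `n` are the density in `lintegral_map_haar`. -/
lemma map_withDensity_jacDensity (h : k ≤ n) (g : Space n ≃ᵃ[ℝ] Space n)
    (hg : MeasurePreserving g volume volume) :
    ((measure h).withDensity (jacDensity g)).map (map g) = measure h := by
  ext B hB
  have hB' : MeasurableSet (map g ⁻¹' B : Set (AffineGrassmannian n k)) := measurable_map h g hB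
  have hd := measurable_jacDensity h g
  rw [Measure.map_apply (measurable_map h g) hB, withDensity_apply _ hB',
    ← lintegral_indicator hB', measure,
    Measure.lintegral_bind measurable_kernel.aemeasurable (hd.indicator hB').aemeasurable]
  change _ = measure h B
  rw [measure_apply h hB, ← Grassmannian.lintegral_map_haar h (linPart g) (abs_det_linPart hg)
    (measurable_volume_fibre hB)]
  refine lintegral_congr fun E => ?_
  have hmk : Measurable fun x : E.1ᗮ => mk E (x : Space n) :=
    measurable_mk.comp (measurable_const.prodMk measurable_subtype_coe)
  rw [lintegral_map (hd.indicator hB') hmk]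
  -- The density depends only on the direction, hence is constant on the fibre over `E`.
  have h1 : ∀ x : E.1ᗮ, (map g ⁻¹' B).indicator (jacDensity g) (mk E (x : Space n)) =
      ((fun x : E.1ᗮ => mk E (x : Space n)) ⁻¹' (map g ⁻¹' B)).indicator
      (fun _ => (ENNReal.ofReal (E.jac (linPart g) ^ (n + 1)))⁻¹) x := by
    intro x
    have h2 : jacDensity g (mk E (x : Space n)) =
        (ENNReal.ofReal (E.jac (linPart g) ^ (n + 1)))⁻¹ := by rw [jacDensity, dir_mk]
    rw [← h2]
    rfl
  have h3 := volume_fibre_map g hg E hB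
  refine (lintegral_congr h1).trans ((lintegral_indicator_const (hmk hB') _).trans
    ((congrArg _ h3).trans ?_))
  have hJ := E.jac_pos (linPart g)
  set J := E.jac (linPart g)
  have hJ0 : ENNReal.ofReal J ≠ 0 := (ENNReal.ofReal_pos.2 hJ).ne'
  rw [pow_succ, ENNReal.ofReal_mul (by positivity), ENNReal.mul_inv
    (Or.inl (ENNReal.ofReal_pos.2 (by positivity)).ne') (Or.inl ENNReal.ofReal_ne_top), mul_assoc,
    ← mul_assoc (ENNReal.ofReal J)⁻¹, ENNReal.inv_mul_cancel hJ0 ENNReal.ofReal_ne_top, one_mul,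
    mul_comm]

end AffineGrassmannian

end AffineGrass

end

theorem mainTheorem5 {n k m : ℕ} (hk : 1 ≤ k) (hkn : k ≤ n) (hm : 0 < m)
    {𝕜 : Type*} [RCLike 𝕜] (p α : Fin m → ℝ) (hp : ∀ i, p i ≠ 0)
    (f : Fin m → AffineGrass.Space n → 𝕜)
    (hf_meas : ∀ i, AEStronglyMeasurable (f i) volume)
    (hf_bdd : ∀ i, ∃ C : ℝ, ∀ x, ‖f i x‖ ≤ C)
    (hf_Lp : ∀ i, ∫⁻ x, ‖f i x‖ₑ ^ p i < ∞)
    (hsum : ∑ i, α i / p i = (n : ℝ) + 1)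
    (hfin : AffineGrass.affineFunctional hkn p α f < ∞)
    (g : AffineGrass.Space n ≃ᵃ[ℝ] AffineGrass.Space n)
    (hg : MeasurePreserving g volume volume) :
    AffineGrass.affineFunctional hkn p α (fun i t => f i (g.symm t)) =
      AffineGrass.affineFunctional hkn p α f := by
  unfold AffineGrass.affineFunctional
  -- Only the measure on the left is replaced by the pushforward, so that substituting `g F` for `F`
  -- yields an integral against `ν` with the density.
  conv_lhs => rw [← AffineGrass.AffineGrassmannian.map_withDensity_jacDensity hkn g hg]
  refine (lintegral_map_equiv _ (AffineGrass.AffineGrassmannian.mapEquiv hkn g)).trans ?_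
  have hpos : ∀ F : AffineGrass.AffineGrassmannian n k,
      0 < F.dir.jac (AffineGrass.linPart g) ^ (n + 1) := fun F =>
    pow_pos (AffineGrass.Grassmannian.jac_pos _ _) _
  -- Finiteness of the density, from `J > 0`, replaces measurability of the integrand in `F`; the
  -- preceding substitution needed none because the action of `g` is a measurable equivalence.
  rw [lintegral_withDensity_eq_lintegral_mul_non_measurable _
    (AffineGrass.AffineGrassmannian.measurable_jacDensity hkn g)
    (ae_of_all _ fun F => ENNReal.inv_lt_top.2 (ENNReal.ofReal_pos.2 (hpos F)))]
  refine lintegral_congr fun F => ?_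
  refine (congrArg (AffineGrass.AffineGrassmannian.jacDensity g F * ·)
    (AffineGrass.prod_planeNorm_map p α f g F hsum)).trans ?_
  change (ENNReal.ofReal _)⁻¹ * (ENNReal.ofReal _ * _) = _
  rw [← mul_assoc, ENNReal.inv_mul_cancel (ENNReal.ofReal_pos.2 (hpos F)).ne'
    ENNReal.ofReal_ne_top, one_mul]
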